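/- Let $n\ge 0$ and let $T$ be a symmetric positive definite $n\times n$ matrix that is half-integral (diagonal entries in $\mathbb Z$, off-diagonal entries in $\tfrac12\mathbb Z$). Put $\operatorname{disc}(T)=\det(2T)$ if $n$ is even and $\operatorname{disc}(T)=\tfrac12\det(2T)$ if $n$ is odd, and assume that $T$ is fundamental, i.e. $\operatorname{disc}(T)$ is odd and square-free. Let $N\ge 1$ be odd with $(\operatorname{disc}(T),N)=1$, let $\chi$ be a Dirichlet character modulo $N$ and $k\in\mathbb Z$. Write $e(w)=e^{2\pi i w}$, $T[x]={}^t x T x$ and $\mathbb H=\{\tau\in\mathbb C:\operatorname{Im}\tau>0\}$. For $g=\begin{pmatrix}a&b\\c&d\end{pmatrix}\in \mathrm{SL}_2(\mathbb Z)$ and $\varphi:\mathbb H\times\mathbb C^n\to\mathbb C$ put $$(\varphi|_{k,T}g)(\tau,z)=\varphi\Big(\frac{a\tau+b}{c\tau+d},\frac{z}{c\tau+d}\Big)(c\tau+d)^{-k}\,e\Big(\frac{-c\,T[z]}{c\tau+d}\Big).$$ Let $\varphi$ be a nonzero cuspidal Jacobi form of weight $k$, index $T$ and nebentypus $\chi$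 for $\Gamma_0(N)$, that is, a nonzero holomorphic function $\varphi:\mathbb H\times\mathbb C^n\to\mathbb C$ such that 1. $\varphi|_{k,T}g=\chi(d)\varphi$ for all $g\in\Gamma_0(N)$; 2. $\varphi(\tau,z+x\tau+y)=e\big(-(T[x]\tau+2\,{}^t xTz)\big)\varphi(\tau,z)$ for all $x,y\in\mathbb Z^n$; 3. for every $g\in\mathrm{SL}_2(\mathbb Z)$ there is an expansion $(\varphi|_{k,T}g)(\tau,z)=\sum_{m\in\frac1N\mathbb Z}\sum_{r\in\mathbb Z^n}c_g(m,r)\,e(m\tau+{}^t r z)$ in which $c_g(m,r)\ne0$ implies that $\begin{pmatrix}m&{}^t r/2\\ r/2&T\end{pmatrix}$ is positive definite. For $\mu\in\mathbb Z^n/2T\mathbb Z^n$ let $$\Theta_{\mu,T}(\tau,z)=\sum_{\ell\in\mathbb Z^n}e\big(T[\ell+\tilde\mu]\,\tau+2\,{}^t(\ell+\tilde\mu)Tz\big),\qquad \tilde\mu=(2T)^{-1}\mu .$$ Then $\varphi$ has a unique theta decomposition $\varphi(\tau,z)=\sum_{\mu\in\mathbb Z^n/2T\mathbb Z^n}h_\mu(\tau)\Theta_{\mu,T}(\tau,z)$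 with functions $h_\mu:\mathbb H\to\mathbb C$, and there exists $\mu$ such that $h_\mu\neq0$ and the rational number $T^{-1}[\mu/2]$ has the maximum possible denominator (in lowest terms) among all $\mu\in\mathbb Z^n/2T\mathbb Z^n$. This maximum possible denominator is $\operatorname{disc}(T)$ if $n$ is even and $4\operatorname{disc}(T)$ if $n$ is odd. -/

import Mathlib

open scoped UpperHalfPlane MatrixGroups
open Matrix

namespace JacobiForms

noncomputable section

/-- `e(w) = exp(2 π i w)`. -/
def e (w : ℂ) : ℂ := Complex.exp (2 * Real.pi * Complex.I * w)

/-- The set `Λ_n^+`: symmetric, half-integral (integral diagonal, entries in `(1/2)ℤ`),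
positive definite matrices. -/
structure PosHalfIntegral (n : ℕ) where
  mat : Matrix (Fin n) (Fin n) ℚ
  symm : mat.IsSymm
  diag_int : ∀ i, ∃ a : ℤ, mat i i = a
  half_int : ∀ i j, ∃ a : ℤ, 2 * mat i j = a
  posDef : (mat.map (fun q : ℚ => (q : ℝ))).PosDef

/-- The bilinear form `ᵗx T y` on complex vectors. In particular `T[x] = bil T x x`. -/
def bil {n : ℕ} (T : Matrix (Fin n) (Fin n) ℚ) (x y : Fin n → ℂ) : ℂ :=
  x ⬝ᵥ (T.map (fun q : ℚ => (q : ℂ)) *ᵥ y)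

/-- The slash operator `φ|_{k,T} g` for `g ∈ SL₂(ℤ)`. -/
def slash {n : ℕ} (k : ℤ) (T : Matrix (Fin n) (Fin n) ℚ) (φ : ℍ → (Fin n → ℂ) → ℂ)
    (g : SL(2, ℤ)) (τ : ℍ) (z : Fin n → ℂ) : ℂ :=
  let c : ℂ := ((g 1 0 : ℤ) : ℂ)
  let j : ℂ := c * (τ : ℂ) + ((g 1 1 : ℤ) : ℂ)
  φ (g • τ) (fun i => z i / j) * j ^ (-k) * e (-(c * bil T z z / j))

/-- `ψ(τ, z) = ∑_{m, r} c(m, r) q^{m/N} ζ^r`, for all `τ` and `z`, with `m ∈ ℤ`, `r ∈ ℤⁿ`.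
(At a cusp other than infinity the exponents of `q` lie in `(1/N)ℤ`.) -/
def HasFourierExpansion {n : ℕ} (N : ℕ) (ψ : ℍ → (Fin n → ℂ) → ℂ)
    (c : ℤ → (Fin n → ℤ) → ℂ) : Prop :=
  ∀ (τ : ℍ) (z : Fin n → ℂ),
    HasSum (fun p : ℤ × (Fin n → ℤ) =>
      c p.1 p.2 * e ((p.1 : ℂ) / (N : ℂ) * (τ : ℂ)) * e (∑ i, (p.2 i : ℂ) * z i)) (ψ τ z)

/-- The real block matrix with rows `(x, ᵗr/2)` and `(r/2, T)`. -/
def blockMat {n : ℕ} (T : Matrix (Fin n) (Fin n) ℚ) (x : ℝ) (r : Fin n → ℤ) :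
    Matrix (Unit ⊕ Fin n) (Unit ⊕ Fin n) ℝ :=
  Matrix.fromBlocks (Matrix.of fun _ _ => x) (Matrix.of fun _ j => (r j : ℝ) / 2)
    (Matrix.of fun i _ => (r i : ℝ) / 2) (T.map (fun q : ℚ => (q : ℝ)))

/-- Scalar-valued Jacobi forms of weight `k`, index `T` and nebentypus `χ` for `Γ₀(N)`. -/
structure IsJacobiForm {n : ℕ} (k : ℤ) (T : Matrix (Fin n) (Fin n) ℚ) (N : ℕ)
    (χ : DirichletCharacter ℂ N) (φ : ℍ → (Fin n → ℂ) → ℂ) : Prop where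
  /-- `φ` is holomorphic on `ℍ × ℂⁿ`. -/
  holo : DifferentiableOn ℂ
    (fun p : ℂ × (Fin n → ℂ) => φ (UpperHalfPlane.ofComplex p.1) p.2) {p | 0 < p.1.im}
  modular : ∀ g ∈ CongruenceSubgroup.Gamma0 N, ∀ (τ : ℍ) (z : Fin n → ℂ),
    slash k T φ g τ z = χ ((g 1 1 : ℤ) : ZMod N) * φ τ z
  elliptic : ∀ (x y : Fin n → ℤ) (τ : ℍ) (z : Fin n → ℂ),
    φ τ (fun i => z i + (x i : ℂ) * (τ : ℂ) + (y i : ℂ)) =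
      e (-(bil T (fun i => (x i : ℂ)) (fun i => (x i : ℂ)) * (τ : ℂ)
        + 2 * bil T (fun i => (x i : ℂ)) z)) * φ τ z
  regular : ∀ g : SL(2, ℤ), ∃ c : ℤ → (Fin n → ℤ) → ℂ,
    HasFourierExpansion N (slash k T φ g) c ∧
      ∀ m r, c m r ≠ 0 → (blockMat T ((m : ℝ) / (N : ℝ)) r).PosSemidef

/-- Cuspidal Jacobi forms: at every cusp only coefficients with positive definite block matrix
occur. -/
structure IsJacobiCuspForm {n : ℕ} (k : ℤ) (T : Matrix (Fin n) (Fin n) ℚ) (N : ℕ)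
    (χ : DirichletCharacter ℂ N) (φ : ℍ → (Fin n → ℂ) → ℂ) : Prop
    extends IsJacobiForm k T N χ φ where
  cuspidal : ∀ g : SL(2, ℤ), ∃ c : ℤ → (Fin n → ℤ) → ℂ,
    HasFourierExpansion N (slash k T φ g) c ∧
      ∀ m r, c m r ≠ 0 → (blockMat T ((m : ℝ) / (N : ℝ)) r).PosDef

/-- `μ̃ = (2T)⁻¹ μ`. -/
def tilde {n : ℕ} (T : Matrix (Fin n) (Fin n) ℚ) (μ : Fin n → ℤ) : Fin n → ℚ :=
  ((2 : ℚ) • T)⁻¹ *ᵥ (fun i => (μ i : ℚ))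

/-- The theta series
`Θ_{μ,T}(τ, z) = ∑_{ℓ ∈ ℤⁿ} e(T[ℓ + μ̃] τ + 2 ᵗ(ℓ + μ̃) T z)`. -/
def theta {n : ℕ} (T : Matrix (Fin n) (Fin n) ℚ) (μ : Fin n → ℤ) (τ : ℍ) (z : Fin n → ℂ) : ℂ :=
  ∑' l : Fin n → ℤ,
    let x : Fin n → ℂ := fun i => (l i : ℂ) + ((tilde T μ i : ℚ) : ℂ)
    e (bil T x x * (τ : ℂ) + 2 * bil T x z)

/-- `T⁻¹[μ/2]`, a rational number. Modulo `ℤ` it depends only on `μ` modulo `2Tℤⁿ`, and so does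
its denominator. -/
def invValue {n : ℕ} (T : Matrix (Fin n) (Fin n) ℚ) (μ : Fin n → ℤ) : ℚ :=
  (fun i => (μ i : ℚ) / 2) ⬝ᵥ (T⁻¹ *ᵥ (fun i => (μ i : ℚ) / 2))

/-- `T⁻¹[μ/2]` has the maximum possible denominator, among all integral vectors. -/
def HasMaxDenominator {n : ℕ} (T : Matrix (Fin n) (Fin n) ℚ) (μ : Fin n → ℤ) : Prop :=
  ∀ ν : Fin n → ℤ, (invValue T ν).den ≤ (invValue T μ).den

namespace PosHalfIntegral

variable {n : ℕ} (T : PosHalfIntegral n)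

/-- `disc(T)`, which is `det(2T)` for even `n` and `det(2T)/2` for odd `n`. -/
def disc : ℚ :=
  if Even n then ((2 : ℚ) • T.mat).det else (1 / 2) * ((2 : ℚ) • T.mat).det

/-- `T` is fundamental: its discriminant is odd and square-free. -/
def IsFundamental : Prop :=
  ∃ d : ℤ, T.disc = d ∧ Odd d ∧ Squarefree d

/-- The sublattice `2Tℤⁿ` of `ℤⁿ`. -/
def lattice : Submodule ℤ (Fin n → ℤ) where
  carrier := {μ | ∃ v : Fin n → ℤ,
    (fun i => (μ i : ℚ)) = ((2 : ℚ) • T.mat) *ᵥ (fun i => (v i : ℚ))}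
  add_mem' := by
    rintro a b ⟨v, hv⟩ ⟨w, hw⟩
    refine ⟨v + w, ?_⟩
    have h1 : (fun i => ((v + w) i : ℚ)) = (fun i => (v i : ℚ)) + (fun i => (w i : ℚ)) := by
      ext i; simp
    rw [h1, Matrix.mulVec_add, ← hv, ← hw]
    ext i; simp
  zero_mem' := ⟨0, by
    have h1 : (fun i => ((0 : Fin n → ℤ) i : ℚ)) = 0 := by ext i; simp
    rw [h1, Matrix.mulVec_zero]⟩
  smul_mem' := by
    rintro a b ⟨v, hv⟩
    refine ⟨a • v, ?_⟩
    have h1 : (fun i => ((a • v) i : ℚ)) = (a : ℚ) • (fun i => (v i : ℚ)) := by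
      ext i; simp
    rw [h1, Matrix.mulVec_smul, ← hv]
    ext i; simp

/-- The group `ℤⁿ/2Tℤⁿ`. -/
abbrev discGroup : Type := (Fin n → ℤ) ⧸ T.lattice

lemma det_ne_zero : ((2 : ℚ) • T.mat).det ≠ 0 := by
  have h := T.posDef.det_pos.ne'
  have h2 : (T.mat.map (fun q : ℚ => (q : ℝ))).det = ((T.mat.det : ℚ) : ℝ) :=
    ((Rat.castHom ℝ).map_det T.mat).symm
  rw [h2] at h
  rw [Matrix.det_smul]
  refine mul_ne_zero (by positivity) ?_
  exact_mod_cast h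

instance finite_discGroup : Finite T.discGroup := by
  choose M hM using T.half_int
  have hMT : (Matrix.of M).map (fun a : ℤ => (a : ℚ)) = (2 : ℚ) • T.mat := by
    ext i j; simp [hM i j]
  have hdet : (Matrix.of M).det ≠ 0 := by
    intro h
    apply T.det_ne_zero
    rw [← hMT]
    have := ((Int.castRingHom ℚ).map_det (Matrix.of M)).symm
    rw [h] at this
    simpa using this
  have hinj : Function.Injective (Matrix.of M).mulVecLin := by
    intro x y hxy
    rw [← sub_eq_zero]
    exact Matrix.eq_zero_of_mulVec_eq_zero hdet (by
      have h3 : (Matrix.of M) *ᵥ x = (Matrix.of M) *ᵥ y := hxy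
      rw [Matrix.mulVec_sub, h3, sub_self])
  have hle : LinearMap.range (Matrix.of M).mulVecLin = T.lattice := by
    ext μ
    constructor
    · rintro ⟨v, rfl⟩
      refine ⟨v, ?_⟩
      rw [← hMT]
      ext i
      simp [Matrix.mulVec, dotProduct]
    · rintro ⟨v, hv⟩
      refine ⟨v, ?_⟩
      rw [← hMT] at hv
      ext i
      have := congrFun hv i
      simp only [Matrix.mulVec, dotProduct, Matrix.map_apply, Matrix.of_apply] at this
      simp only [Matrix.mulVecLin_apply, Matrix.mulVec, dotProduct, Matrix.of_apply]
      exact_mod_cast this.symm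
  refine Submodule.finiteQuotientOfFreeOfRankEq T.lattice ?_
  rw [← hle]
  exact LinearMap.finrank_range_of_inj hinj

instance fintype_discGroup : Fintype T.discGroup := Fintype.ofFinite _

lemma theta_congr (μ ν : Fin n → ℤ) (h : μ - ν ∈ T.lattice) :
    theta T.mat μ = theta T.mat ν := by
  obtain ⟨v, hv⟩ := h
  have hunit : IsUnit ((2 : ℚ) • T.mat).det := T.det_ne_zero.isUnit
  have htilde : tilde T.mat μ = tilde T.mat ν + fun i => (v i : ℚ) := by
    have h1 : (fun i => (μ i : ℚ)) =
        (fun i => (ν i : ℚ)) + ((2 : ℚ) • T.mat) *ᵥ (fun i => (v i : ℚ)) := by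
      rw [← hv]; ext i; simp
    unfold tilde
    rw [h1, Matrix.mulVec_add, Matrix.mulVec_mulVec, Matrix.nonsing_inv_mul _ hunit,
      Matrix.one_mulVec]
  ext τ z
  unfold theta
  rw [← (Equiv.addRight v).tsum_eq (fun l : Fin n → ℤ =>
    let x : Fin n → ℂ := fun i => (l i : ℂ) + ((tilde T.mat ν i : ℚ) : ℂ)
    e (bil T.mat x x * (τ : ℂ) + 2 * bil T.mat x z))]
  refine tsum_congr fun l => ?_
  have hx : (fun i => (l i : ℂ) + ((tilde T.mat μ i : ℚ) : ℂ)) =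
      fun i => (((Equiv.addRight v) l i : ℤ) : ℂ) + ((tilde T.mat ν i : ℚ) : ℂ) := by
    ext i
    rw [htilde]
    simp
    ring
  simp only [hx]

/-- `Θ_{μ,T}` for a class `μ ∈ ℤⁿ/2Tℤⁿ`. -/
def thetaClass (μ : T.discGroup) : ℍ → (Fin n → ℂ) → ℂ :=
  Quotient.lift (theta T.mat) (fun a b hab => T.theta_congr a b
    ((Submodule.quotientRel_def T.lattice).mp hab)) μ

/-- `φ = ∑_μ h_μ Θ_{μ,T}`, the sum being over `μ ∈ ℤⁿ/2Tℤⁿ`: the functions `h_μ` are the theta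
components of `φ`. -/
def IsThetaDecomposition (φ : ℍ → (Fin n → ℂ) → ℂ) (h : T.discGroup → ℍ → ℂ) : Prop :=
  ∀ (τ : ℍ) (z : Fin n → ℂ), φ τ z = ∑ μ : T.discGroup, h μ τ * T.thetaClass μ τ z

end PosHalfIntegral

end

end JacobiForms

namespace JacobiForms

/-! ### Fourier analysis on a finite abelian group of squarefree order -/

section FiniteGroup

variable {D : Type*} [AddCommGroup D] [Fintype D]

/-! Let D be the discriminant group `T.discGroup`, B(μ,ν) = ᵗμ(2T)⁻¹ν and Q(μ) = T⁻¹[μ/2] modulo 1.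
Fundamentality makes |D| squarefree, so D is cyclic, and the denominator of Q is maximal at its
generators (`IsFundamental.den_invValue`). It therefore suffices that φ = 0 whenever all h_μ with μ
a generator vanish (`IsFundamental.eq_zero_of_components_eq_zero`).

Let ψ = φ|S with theta components u(τ). The Fourier transform of u(τ) on D vanishes at ν exactly
when h_ν(Sτ) does (`fourier_component_eq_zero_iff`). Only vanishing is needed, so translations of z
by τb̃ suffice in place of the explicit theta inversion formula. Since ψ is invariant under τ ↦ τ +
N, replacing τ by τ + jN multiplies u_μ by e(-jNQ(μ)). Hence the transforms of all u·ω^j, with ω =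
e(-NQ), vanish at the generators.

By interpolation ω^j may be replaced by any function of ω. As N is prime to the level, ω determines
Q; as |D| is squarefree and Q(kγ) = k²Q(γ), the value of Q decides membership in each torsion
subgroup D[a]. So u·1_{D[a]} has a transform vanishing at generators. For ab = |D| this transform
is, up to a nonzero scalar, the sum of the transform of u over cosets of D[b], and such coset sums
through generators determine a function (`eq_zero_of_sum_coset_eq_zero`). Thus u has zero transform,
every h_ν vanishes, and φ = 0. -/

lemma isAddCyclic_of_squarefree_card (hD : Squarefree (Nat.card D)) : IsAddCyclic D := by
  have h : Squarefree (Nat.card (Multiplicative D)) := hD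
  have := IsZGroup.of_squarefree h
  have h2 : IsCyclic (Multiplicative D) := inferInstance
  exact isCyclic_multiplicative_iff.mp h2

/-- A function on a finite abelian group of squarefree order vanishes as soon as its sums over
the cosets of torsion subgroups through generators vanish. -/
lemma eq_zero_of_sum_coset_eq_zero [DecidableEq D] (hD : Squarefree (Nat.card D)) (f : D → ℂ)
    (hf : ∀ x : D, addOrderOf x = Nat.card D → ∀ a b : ℕ, a * b = Nat.card D →
      ∑ h ∈ Finset.univ.filter (fun h : D => b • h = 0), f (x + h) = 0) : f = 0 := by
  have := isAddCyclic_of_squarefree_card hD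
  obtain ⟨γ, hγ⟩ := IsAddCyclic.exists_generator (α := D)
  have hγ' : addOrderOf γ = Nat.card D := addOrderOf_eq_card_of_forall_mem_zmultiples hγ
  have hpos : 0 < Nat.card D := Nat.card_pos
  -- Induction on |D| - ord(x): elements of larger order are settled first.
  suffices H : ∀ k : ℕ, ∀ x : D, Nat.card D - addOrderOf x = k → f x = 0 by
    ext x; exact H _ x rfl
  intro k
  induction k using Nat.strong_induction_on with
  | _ k ih =>
    intro x hx
    have hxd : addOrderOf x ∣ Nat.card D := addOrderOf_dvd_natCard x
    obtain ⟨b, hb⟩ := hxd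
    have ha0 : 0 < addOrderOf x := addOrderOf_pos x
    have hb0 : 0 < b := Nat.pos_of_ne_zero (by rintro rfl; omega)
    have hcop : (addOrderOf x).Coprime b := Nat.coprime_of_squarefree_mul (hb ▸ hD)
    have hord : ∀ h : D, b • h = 0 → addOrderOf (x + h) = addOrderOf x * addOrderOf h := by
      intro h hh
      refine (AddCommute.all x h).addOrderOf_add_eq_mul_addOrderOf_of_coprime ?_
      exact hcop.coprime_dvd_right (addOrderOf_dvd_of_nsmul_eq_zero hh)
    have h0 : b • (addOrderOf x • γ) = 0 := by
      rw [← mul_nsmul, ← hb, ← hγ', addOrderOf_nsmul_eq_zero]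
    have h0ord : addOrderOf (addOrderOf x • γ) = b := by
      rw [addOrderOf_nsmul' γ ha0.ne', hγ', hb, Nat.gcd_eq_right (Dvd.intro _ rfl),
        Nat.mul_div_cancel_left _ ha0]
    -- With a = ord(x) and b = |D|/a, the coset x + D[b] contains the generator x + aγ.
    have hs := hf (x + addOrderOf x • γ) (by rw [hord _ h0, h0ord, ← hb]) _ _ hb.symm
    have hs2 : ∑ h ∈ Finset.univ.filter (fun h : D => b • h = 0), f (x + h) = 0 := by
      rw [← hs]
      symm
      refine Finset.sum_bij (fun h _ => addOrderOf x • γ + h) ?_ ?_ ?_ ?_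
      · intro h hh
        simp only [Finset.mem_filter, Finset.mem_univ, true_and] at hh ⊢
        rw [nsmul_add, h0, hh, add_zero]
      · intro h _ h' _ heq
        exact add_left_cancel heq
      · intro h hh
        simp only [Finset.mem_filter, Finset.mem_univ, true_and] at hh
        refine ⟨h - addOrderOf x • γ, ?_, by abel⟩
        simp only [Finset.mem_filter, Finset.mem_univ, true_and]
        rw [nsmul_sub, h0, hh, sub_zero]
      · intro h _
        rw [add_assoc]
    -- For h ≠ 0 in D[b] the order of x + h is ord(x)·ord(h) > ord(x), so induction removes every
    -- other term.
    rw [Finset.sum_eq_single_of_mem 0 (by simp)] at hs2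
    · simpa using hs2
    · intro h hh hne
      simp only [Finset.mem_filter, Finset.mem_univ, true_and] at hh
      have h1 : addOrderOf h ≠ 1 := by rwa [Ne, AddMonoid.addOrderOf_eq_one_iff]
      have h2 : 0 < addOrderOf h := addOrderOf_pos h
      have h3 : addOrderOf x < addOrderOf (x + h) := by
        rw [hord h hh]
        exact lt_mul_of_one_lt_right ha0 (by omega)
      have h4 : addOrderOf (x + h) ≤ Nat.card D :=
        Nat.le_of_dvd hpos (addOrderOf_dvd_natCard _)
      exact ih (Nat.card D - addOrderOf (x + h)) (by omega) (x + h) rfl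

/-- On the finite set of values of `w`, any `G` agrees with its Lagrange interpolation polynomial,
so the vanishing power moments suffice. -/
lemma sum_mul_comp_eq_zero_of_sum_mul_pow_eq_zero {ι : Type*} [Fintype ι] (f w : ι → ℂ)
    (h : ∀ j : ℕ, ∑ i, f i * w i ^ j = 0) (G : ℂ → ℂ) : ∑ i, f i * G (w i) = 0 := by
  classical
  let s : Finset ℂ := Finset.univ.image w
  let P := Lagrange.interpolate s id G
  have hP : ∀ i, P.eval (w i) = G (w i) := fun i =>
    Lagrange.eval_interpolate_at_node (v := id) G Function.injective_id.injOn
      (Finset.mem_image_of_mem w (Finset.mem_univ i))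
  simp_rw [← hP, Polynomial.eval_eq_sum_range, Finset.mul_sum]
  rw [Finset.sum_comm]
  refine Finset.sum_eq_zero fun j _ => ?_
  have := congrArg (P.coeff j * ·) (h j)
  simp only [Finset.mul_sum, mul_zero] at this
  rw [← this]
  exact Finset.sum_congr rfl fun i _ => by ring

/-- If the Fourier transforms of all `ω ^ j * u` vanish at the generators, and the level sets of
`ω` respect torsion, then the Fourier transform of `u` vanishes. -/
lemma fourier_eq_zero_of_vanish_on_generators [DecidableEq D] (hD : Squarefree (Nat.card D))
    (E : D → AddChar D ℂ) (hsymm : ∀ x y, E x y = E y x)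
    (hnd : ∀ x, (∀ y, E x y = 1) → x = 0) (ω u : D → ℂ)
    (hω : ∀ x y, ω x = ω y → ∀ a b : ℕ, a * b = Nat.card D → a • x = 0 → a • y = 0)
    (hu : ∀ x : D, addOrderOf x = Nat.card D → ∀ j : ℕ, ∑ y, E x y * u y * ω y ^ j = 0)
    (x : D) : ∑ y, E x y * u y = 0 := by
  suffices H : (fun x => ∑ y, E x y * u y) = 0 from congrFun H x
  refine eq_zero_of_sum_coset_eq_zero hD _ fun x hx a b hab => ?_
  have hadd : ∀ x h y, E (x + h) y = E x y * E h y := fun x h y => by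
    rw [hsymm, AddChar.map_add_eq_mul, hsymm y x, hsymm y h]
  have hnsmul : ∀ (m : ℕ) x y, E (m • x) y = E x (m • y) := fun m x y => by
    rw [hsymm, AddChar.map_nsmul_eq_pow, AddChar.map_nsmul_eq_pow, hsymm]
  rw [Finset.sum_comm]
  set H := Finset.univ.filter (fun h : D => b • h = 0) with hH
  -- The annihilator of D[b] is D[a]: coprimality of a and b gives D[b] = aD, and the pairing is
  -- nondegenerate.
  have hchar : ∀ y, ∑ h ∈ H, E h y = if a • y = 0 then (H.card : ℂ) else 0 := by
    intro y
    split_ifs with hy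
    · rw [Finset.sum_congr rfl (g := fun _ => (1 : ℂ)), Finset.sum_const, nsmul_eq_mul, mul_one]
      intro h hh
      have hb : b • h = 0 := by simpa [hH] using hh
      obtain ⟨p, hp⟩ : ∃ p : D, h = a • p := by
        have hcop : IsCoprime (a : ℤ) (b : ℤ) :=
          Nat.isCoprime_iff_coprime.mpr (Nat.coprime_of_squarefree_mul (hab ▸ hD))
        obtain ⟨s, t, hst⟩ := hcop
        refine ⟨s • h, ?_⟩
        have h1 : ((s * a + t * b : ℤ)) • h = h := by rw [hst, one_zsmul]
        rw [add_smul, mul_smul, mul_smul, natCast_zsmul, natCast_zsmul, hb, smul_zero, add_zero,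
          smul_comm] at h1
        exact h1.symm
      rw [hp, hnsmul, hy, AddChar.map_zero_eq_one]
    · obtain ⟨z, hz⟩ : ∃ z, E (a • y) z ≠ 1 := by
        by_contra! hcon
        exact hy (hnd _ hcon)
      have hz' : a • z ∈ H := by
        simp only [hH, Finset.mem_filter, Finset.mem_univ, true_and]
        rw [← mul_nsmul, hab, card_nsmul_eq_zero']
      have hEz : E (a • z) y ≠ 1 := by rwa [hnsmul, hsymm]
      -- Translating the sum by a • z in D[b] multiplies it by a factor different from 1, so the sum
      -- is zero.
      have hshift : ∑ h ∈ H, E h y = E (a • z) y * ∑ h ∈ H, E h y := by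
        rw [Finset.mul_sum]
        symm
        refine Finset.sum_bij (fun h _ => a • z + h) ?_ (fun _ _ _ _ h => add_left_cancel h) ?_ ?_
        · intro h hh
          simp only [hH, Finset.mem_filter, Finset.mem_univ, true_and] at hh hz' ⊢
          rw [nsmul_add, hz', hh, add_zero]
        · intro h hh
          simp only [hH, Finset.mem_filter, Finset.mem_univ, true_and] at hh hz'
          refine ⟨h - a • z, ?_, by abel⟩
          simp only [hH, Finset.mem_filter, Finset.mem_univ, true_and]
          rw [nsmul_sub, hz', hh, sub_zero]
        · intro h _
          rw [hadd]
      have h0 : (E (a • z) y - 1) * ∑ h ∈ H, E h y = 0 := by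
        rw [sub_mul, one_mul, ← hshift, sub_self]
      exact (mul_eq_zero.mp h0).resolve_left (sub_ne_zero.mpr hEz)
  -- By `hω` the indicator of D[a] is a function of ω, so it may be inserted in place of a power of
  -- ω.
  have hG := sum_mul_comp_eq_zero_of_sum_mul_pow_eq_zero (fun y => E x y * u y) ω (hu x hx)
    (fun c => if ∃ y, ω y = c ∧ a • y = 0 then (H.card : ℂ) else 0)
  rw [← hG]
  refine Finset.sum_congr rfl fun y _ => ?_
  have hiff : (∃ y', ω y' = ω y ∧ a • y' = 0) ↔ a • y = 0 :=
    ⟨fun ⟨y', h1, h2⟩ => hω y' y h1 a b hab h2, fun h => ⟨y, rfl, h⟩⟩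
  rw [if_congr hiff rfl rfl, ← hchar y, Finset.mul_sum]
  exact Finset.sum_congr rfl fun h _ => by rw [hadd]; ring

end FiniteGroup

end JacobiForms

/-! ### The exponential e and rationals modulo the integers -/

namespace JacobiForms

lemma e_add (x y : ℂ) : e (x + y) = e x * e y := by
  rw [e, e, e, ← Complex.exp_add]; congr 1; ring

lemma e_zero : e 0 = 1 := by simp [e]

lemma e_ne_zero (x : ℂ) : e x ≠ 0 := Complex.exp_ne_zero _

lemma e_neg (x : ℂ) : e (-x) = (e x)⁻¹ := by
  refine eq_inv_of_mul_eq_one_left ?_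
  rw [← e_add, neg_add_cancel, e_zero]

lemma e_intCast (m : ℤ) : e (m : ℂ) = 1 := by
  rw [e, Complex.exp_eq_one_iff]
  exact ⟨m, by ring⟩

lemma e_natCast_mul (j : ℕ) (x : ℂ) : e (j * x) = e x ^ j := by
  rw [e, e, ← Complex.exp_nat_mul]; congr 1; ring

/-- The integers inside `ℚ`. -/
abbrev ratInt : AddSubgroup ℚ := (Int.castAddHom ℚ).range

lemma intCast_mem_ratInt (m : ℤ) : (m : ℚ) ∈ ratInt := ⟨m, rfl⟩

lemma intCast_mul_mem_ratInt (m : ℤ) {x : ℚ} (hx : x ∈ ratInt) : (m : ℚ) * x ∈ ratInt := by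
  obtain ⟨a, rfl⟩ := hx
  exact ⟨m * a, by simp⟩

lemma e_ratCast_eq_one_iff (q : ℚ) : e (q : ℂ) = 1 ↔ q ∈ ratInt := by
  rw [e, Complex.exp_eq_one_iff]
  constructor
  · rintro ⟨m, hm⟩
    refine ⟨m, ?_⟩
    have h2 := Complex.two_pi_I_ne_zero
    have : (q : ℂ) = m := by
      apply mul_left_cancel₀ h2
      rw [hm]; ring
    simp only [Int.coe_castAddHom]
    exact_mod_cast this.symm
  · rintro ⟨m, rfl⟩
    exact ⟨m, by simp; ring⟩

lemma e_ratCast_eq_iff (p q : ℚ) : e (p : ℂ) = e (q : ℂ) ↔ p - q ∈ ratInt := by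
  rw [← e_ratCast_eq_one_iff]
  push_cast
  rw [sub_eq_add_neg, e_add, e_neg, mul_inv_eq_one₀ (e_ne_zero _)]

lemma den_dvd_of_mul_mem {m : ℕ} (hm : m ≠ 0) {q : ℚ} (h : (m : ℚ) * q ∈ ratInt) :
    q.den ∣ m := by
  obtain ⟨z, hz⟩ := h
  have hz' : (z : ℚ) = m * q := hz
  have hq : q = Rat.divInt z m := by
    rw [Rat.divInt_eq_div, hz']
    have : (m : ℚ) ≠ 0 := by exact_mod_cast hm
    push_cast
    field_simp
  have := Rat.den_dvd z m
  rw [← hq] at this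
  exact_mod_cast this

lemma den_mul_mem (q : ℚ) : (q.den : ℚ) * q ∈ ratInt :=
  ⟨q.num, by simp [Rat.den_mul_eq_num]⟩

/-! ### The discriminant form, its level and the denominators of its values -/

namespace PosHalfIntegral

variable {n : ℕ} (T : PosHalfIntegral n)

/-- The even integral matrix `2T`. -/
noncomputable def gram : Matrix (Fin n) (Fin n) ℤ := Matrix.of fun i j => (T.half_int i j).choose

lemma gram_map : T.gram.map (Int.cast : ℤ → ℚ) = (2 : ℚ) • T.mat := by
  ext i j
  simp [gram, ← (T.half_int i j).choose_spec]

lemma gram_map_mulVec (v : Fin n → ℤ) :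
    (fun i => ((T.gram *ᵥ v) i : ℚ)) = ((2 : ℚ) • T.mat) *ᵥ (fun i => (v i : ℚ)) := by
  rw [← gram_map]
  ext i
  simp [Matrix.mulVec, dotProduct]

lemma mem_lattice_iff (μ : Fin n → ℤ) : μ ∈ T.lattice ↔ ∃ v, μ = T.gram *ᵥ v := by
  refine exists_congr fun v => ?_
  rw [← gram_map_mulVec]
  constructor
  · intro h
    ext i
    exact_mod_cast congrFun h i
  · rintro rfl; rfl

/-- The pairing `ᵗμ (2T)⁻¹ ν`. -/
noncomputable def pairing (μ ν : Fin n → ℤ) : ℚ :=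
  (fun i => (μ i : ℚ)) ⬝ᵥ (((2 : ℚ) • T.mat)⁻¹ *ᵥ fun i => (ν i : ℚ))

lemma inv_symm : (((2 : ℚ) • T.mat)⁻¹)ᵀ = ((2 : ℚ) • T.mat)⁻¹ := by
  rw [Matrix.transpose_nonsing_inv, Matrix.transpose_smul, T.symm]

lemma pairing_comm (μ ν : Fin n → ℤ) : T.pairing μ ν = T.pairing ν μ := by
  rw [pairing, pairing, Matrix.dotProduct_mulVec, ← Matrix.mulVec_transpose, inv_symm,
    dotProduct_comm]

lemma pairing_add_right (μ ν ρ : Fin n → ℤ) :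
    T.pairing μ (ν + ρ) = T.pairing μ ν + T.pairing μ ρ := by
  rw [pairing, pairing, pairing, ← dotProduct_add, ← Matrix.mulVec_add]
  congr; ext i; simp

lemma pairing_add_left (μ ν ρ : Fin n → ℤ) :
    T.pairing (μ + ν) ρ = T.pairing μ ρ + T.pairing ν ρ := by
  rw [pairing_comm, pairing_add_right, pairing_comm, T.pairing_comm ρ]

lemma pairing_zsmul_right (m : ℤ) (μ ν : Fin n → ℤ) :
    T.pairing μ (m • ν) = m * T.pairing μ ν := by
  rw [pairing, pairing, ← smul_eq_mul (m : ℚ), ← dotProduct_smul, ← Matrix.mulVec_smul]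
  congr; ext i; simp

lemma pairing_zsmul_left (m : ℤ) (μ ν : Fin n → ℤ) :
    T.pairing (m • μ) ν = m * T.pairing μ ν := by
  rw [pairing_comm, pairing_zsmul_right, pairing_comm]

lemma pairing_gram_right (μ v : Fin n → ℤ) :
    T.pairing μ (T.gram *ᵥ v) = ((μ ⬝ᵥ v : ℤ) : ℚ) := by
  rw [pairing, gram_map_mulVec, Matrix.mulVec_mulVec,
    Matrix.nonsing_inv_mul _ T.det_ne_zero.isUnit, Matrix.one_mulVec]
  simp [dotProduct]

lemma pairing_mem_of_mem (μ : Fin n → ℤ) {ν : Fin n → ℤ} (hν : ν ∈ T.lattice) :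
    T.pairing μ ν ∈ ratInt := by
  obtain ⟨v, rfl⟩ := (T.mem_lattice_iff ν).mp hν
  exact ⟨_, (T.pairing_gram_right μ v).symm⟩

/-- Nondegeneracy: pairing with the unit vectors reads off the coordinates of (2T)⁻¹μ. -/
lemma mem_lattice_of_pairing_mem (μ : Fin n → ℤ) (h : ∀ ν, T.pairing μ ν ∈ ratInt) :
    μ ∈ T.lattice := by
  choose v hv using fun i => h (Pi.single i 1)
  refine ⟨v, ?_⟩
  have hv' : (fun i => (v i : ℚ)) = ((2 : ℚ) • T.mat)⁻¹ *ᵥ (fun i => (μ i : ℚ)) := by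
    ext i
    have : (v i : ℚ) = T.pairing μ (Pi.single i 1) := hv i
    rw [this, pairing_comm, pairing]
    have h1 : (fun j => ((Pi.single i 1 : Fin n → ℤ) j : ℚ)) = Pi.single i 1 := by
      ext j
      by_cases hj : j = i
      · subst hj; simp
      · simp [hj]
    rw [h1, single_one_dotProduct]
  rw [hv', Matrix.mulVec_mulVec, Matrix.mul_nonsing_inv _ T.det_ne_zero.isUnit, Matrix.one_mulVec]

lemma invValue_eq (μ : Fin n → ℤ) : invValue T.mat μ = T.pairing μ μ / 2 := by
  have hdet : IsUnit T.mat.det := by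
    have := T.det_ne_zero
    rw [Matrix.det_smul] at this
    exact (right_ne_zero_of_mul this).isUnit
  have hinv : ((2 : ℚ) • T.mat)⁻¹ = (2⁻¹ : ℚ) • T.mat⁻¹ := by
    apply Matrix.inv_eq_right_inv
    rw [Matrix.smul_mul, Matrix.mul_smul, smul_smul, Matrix.mul_nonsing_inv _ hdet]
    norm_num
  have h2 : (fun i => (μ i : ℚ) / 2) = (2⁻¹ : ℚ) • fun i => (μ i : ℚ) := by
    ext i; simp; ring
  rw [invValue, pairing, hinv, h2, Matrix.mulVec_smul, Matrix.smul_mulVec, dotProduct_smul,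
    dotProduct_smul, smul_dotProduct]
  simp only [smul_eq_mul]
  ring

lemma invValue_add (μ ν : Fin n → ℤ) :
    invValue T.mat (μ + ν) = invValue T.mat μ + invValue T.mat ν + T.pairing μ ν := by
  rw [invValue_eq, invValue_eq, invValue_eq, pairing_add_left, pairing_add_right,
    pairing_add_right, T.pairing_comm ν μ]
  ring

lemma invValue_zsmul (m : ℤ) (μ : Fin n → ℤ) :
    invValue T.mat (m • μ) = m ^ 2 * invValue T.mat μ := by
  rw [invValue_eq, invValue_eq, pairing_zsmul_left, pairing_zsmul_right]
  ring

/-- The value is T[v]. The vectors with integral value form a subgroup because the cross terms are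
integral, and it contains the unit vectors because the diagonal of T is integral. -/
lemma invValue_gram_mulVec_mem (v : Fin n → ℤ) : invValue T.mat (T.gram *ᵥ v) ∈ ratInt := by
  let A : AddSubgroup (Fin n → ℤ) :=
    { carrier := {v | invValue T.mat (T.gram *ᵥ v) ∈ ratInt}
      add_mem' := by
        intro v w hv hw
        simp only [Set.mem_ofPred_eq] at *
        rw [Matrix.mulVec_add, invValue_add]
        exact add_mem (add_mem hv hw) (by rw [pairing_gram_right]; exact intCast_mem_ratInt _)
      zero_mem' := by
        simp only [Set.mem_ofPred_eq]
        rw [Matrix.mulVec_zero, ← zero_smul ℤ (0 : Fin n → ℤ), invValue_zsmul]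
        simp
      neg_mem' := by
        intro v hv
        simp only [Set.mem_ofPred_eq] at *
        rw [Matrix.mulVec_neg, ← neg_one_smul ℤ (T.gram *ᵥ v), invValue_zsmul]
        simpa using hv }
  suffices H : v ∈ A from H
  rw [pi_eq_sum_univ' v]
  refine sum_mem fun i _ => zsmul_mem ?_ _
  change invValue T.mat (T.gram *ᵥ _) ∈ ratInt
  rw [invValue_eq, pairing_gram_right]
  obtain ⟨a, ha⟩ := T.diag_int i
  have hg : (T.gram i i : ℚ) = 2 * a := by
    have := congrFun (congrFun T.gram_map i) i
    simpa [ha] using this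
  refine ⟨a, ?_⟩
  rw [dotProduct_single_one, Matrix.mulVec_single_one]
  simp [hg]

lemma invValue_add_gram (μ v : Fin n → ℤ) :
    invValue T.mat (μ + T.gram *ᵥ v) =
      invValue T.mat μ + invValue T.mat (T.gram *ᵥ v) + ((μ ⬝ᵥ v : ℤ) : ℚ) := by
  rw [invValue_add, pairing_gram_right]

lemma invValue_sub_mem {μ ν : Fin n → ℤ} (h : μ - ν ∈ T.lattice) :
    invValue T.mat μ - invValue T.mat ν ∈ ratInt := by
  obtain ⟨v, hv⟩ := (T.mem_lattice_iff _).mp h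
  rw [sub_eq_iff_eq_add'] at hv
  rw [hv, invValue_add_gram, add_assoc, add_sub_cancel_left]
  exact add_mem (T.invValue_gram_mulVec_mem v) (intCast_mem_ratInt _)

lemma card_discGroup : (Nat.card T.discGroup : ℚ) = ((2 : ℚ) • T.mat).det := by
  have hdetQ : ((T.gram.det : ℤ) : ℚ) = ((2 : ℚ) • T.mat).det := by
    rw [← gram_map]
    exact (Int.castRingHom ℚ).map_det T.gram
  have hdet : T.gram.det ≠ 0 := by
    intro h
    apply T.det_ne_zero
    rw [← hdetQ, h, Int.cast_zero]
  have hinj : Function.Injective T.gram.mulVecLin := by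
    intro x y hxy
    rw [← sub_eq_zero]
    refine Matrix.eq_zero_of_mulVec_eq_zero hdet ?_
    have h3 : T.gram *ᵥ x = T.gram *ᵥ y := hxy
    rw [Matrix.mulVec_sub, h3, sub_self]
  have hrange : LinearMap.range T.gram.mulVecLin = T.lattice := by
    ext μ
    rw [mem_lattice_iff]
    exact exists_congr fun v => by rw [Matrix.mulVecLin_apply, eq_comm]
  let f : (Fin n → ℤ) ≃ₗ[ℤ] T.lattice :=
    (LinearEquiv.ofInjective _ hinj).trans (LinearEquiv.ofEq _ _ hrange)
  have h := Submodule.natAbs_det_equiv T.lattice f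
  have hcomp : T.lattice.subtype ∘ₗ AddMonoidHom.toIntLinearMap (f : (Fin n → ℤ) →+ T.lattice) =
      T.gram.mulVecLin := by
    ext; rfl
  rw [hcomp, ← Matrix.toLin'_apply', LinearMap.det_toLin'] at h
  rw [← h, ← hdetQ]
  have hpos : 0 < T.gram.det := by
    have h1 := T.posDef.det_pos
    have h2 : (T.mat.map (fun q : ℚ => (q : ℝ))).det = ((T.mat.det : ℚ) : ℝ) :=
      ((Rat.castHom ℝ).map_det T.mat).symm
    rw [h2] at h1
    have h3 : 0 < T.mat.det := by exact_mod_cast h1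
    have h4 : 0 < ((2 : ℚ) • T.mat).det := by rw [Matrix.det_smul]; positivity
    rw [← hdetQ] at h4
    exact_mod_cast h4
  rw [Nat.cast_natAbs, abs_of_pos hpos]

/-- The maximal denominator of `T⁻¹[μ/2]`. -/
noncomputable def level : ℕ := if Even n then Nat.card T.discGroup else 2 * Nat.card T.discGroup

lemma level_eq : (T.level : ℚ) = if Even n then T.disc else 4 * T.disc := by
  unfold level disc
  split_ifs
  · exact T.card_discGroup
  · push_cast
    rw [T.card_discGroup]
    ring

lemma level_pos : 0 < T.level := by
  have : 0 < Nat.card T.discGroup := Nat.card_pos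
  unfold level
  split_ifs <;> omega

variable {T} in
lemma IsFundamental.odd_card (hT : T.IsFundamental) (hn : Even n) : Odd (Nat.card T.discGroup) := by
  obtain ⟨d, hd, hodd, -⟩ := hT
  rw [disc, if_pos hn, ← T.card_discGroup] at hd
  have : (Nat.card T.discGroup : ℤ) = d := by exact_mod_cast hd
  rw [← this] at hodd
  exact_mod_cast hodd

lemma card_eq_of_not_even {d : ℤ} (hd : T.disc = d) (hn : ¬ Even n) :
    (Nat.card T.discGroup : ℤ) = 2 * d := by
  rw [disc, if_neg hn, ← T.card_discGroup] at hd
  have : (Nat.card T.discGroup : ℚ) = 2 * d := by rw [← hd]; ring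
  exact_mod_cast this

variable {T} in
lemma IsFundamental.squarefree_card (hT : T.IsFundamental) :
    Squarefree (Nat.card T.discGroup) := by
  obtain ⟨d, hd, hodd, hsq⟩ := hT
  rw [← Int.squarefree_natCast]
  by_cases hn : Even n
  · rw [disc, if_pos hn, ← T.card_discGroup] at hd
    have : (Nat.card T.discGroup : ℤ) = d := by exact_mod_cast hd
    rwa [this]
  · rw [T.card_eq_of_not_even hd hn]
    have hcop : IsCoprime (2 : ℤ) d := by
      rw [Int.isCoprime_iff_gcd_eq_one]
      have := hodd.natAbs
      exact (Nat.coprime_two_left.mpr this)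
    exact squarefree_mul_iff.mpr ⟨hcop.isRelPrime, Int.prime_two.squarefree, hsq⟩

variable {T} in
lemma IsFundamental.isCoprime_level (hT : T.IsFundamental) {N : ℕ} (hN : Odd N)
    (hcop : IsCoprime T.disc.num (N : ℤ)) : IsCoprime (T.level : ℤ) (N : ℤ) := by
  obtain ⟨d, hd, -, -⟩ := hT
  have h2 : IsCoprime (2 : ℤ) (N : ℤ) := by
    exact Nat.isCoprime_iff_coprime.mpr (Nat.coprime_two_left.mpr hN)
  have hl := T.level_eq
  rw [hd] at hl hcop
  rw [Rat.num_intCast] at hcop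
  split_ifs at hl with hn
  · have : (T.level : ℤ) = d := by exact_mod_cast hl
    rwa [this]
  · have : (T.level : ℤ) = 2 * 2 * d := by norm_num; exact_mod_cast hl
    rw [this]
    exact (h2.mul_left h2).mul_left hcop

lemma card_smul_mem_lattice (μ : Fin n → ℤ) : (Nat.card T.discGroup : ℤ) • μ ∈ T.lattice := by
  rw [← Submodule.Quotient.mk_eq_zero, Submodule.Quotient.mk_smul, natCast_zsmul,
    card_nsmul_eq_zero']

variable {T} in
lemma IsFundamental.level_mul_invValue_mem (hT : T.IsFundamental) (μ : Fin n → ℤ) :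
    (T.level : ℚ) * invValue T.mat μ ∈ ratInt := by
  have h2 : ((2 * Nat.card T.discGroup : ℕ) : ℚ) * invValue T.mat μ ∈ ratInt := by
    have := T.pairing_mem_of_mem μ (T.card_smul_mem_lattice μ)
    rw [pairing_zsmul_right] at this
    rw [invValue_eq]
    convert this using 1
    push_cast; ring
  by_cases hn : Even n
  · obtain ⟨v, hv⟩ := (T.mem_lattice_iff _).mp (T.card_smul_mem_lattice μ)
    have h3 := T.invValue_gram_mulVec_mem v
    rw [← hv, invValue_zsmul] at h3
    obtain ⟨k, hk⟩ := hT.odd_card hn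
    rw [level, if_pos hn]
    -- With |D| = 2k + 1 one has |D|² - k·2|D| = |D|, so integrality of |D|²Q(μ) and 2|D|Q(μ)
    -- removes the factor 2.
    have h4 := sub_mem h3 (intCast_mul_mem_ratInt k h2)
    convert h4 using 1
    rw [hk]; push_cast; ring
  · rwa [level, if_neg hn]

lemma exists_zsmul_sub_mem {μ : Fin n → ℤ}
    (hμ : addOrderOf (Submodule.Quotient.mk μ : T.discGroup) = Nat.card T.discGroup)
    (ν : Fin n → ℤ) : ∃ j : ℤ, ν - j • μ ∈ T.lattice := by
  have hmem : (Submodule.Quotient.mk ν : T.discGroup) ∈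
      AddSubgroup.zmultiples (Submodule.Quotient.mk μ : T.discGroup) := by
    have : AddSubgroup.zmultiples (Submodule.Quotient.mk μ : T.discGroup) = ⊤ := by
      apply AddSubgroup.eq_top_of_card_eq
      rw [Nat.card_zmultiples, hμ]
    rw [this]; trivial
  obtain ⟨j, hj⟩ := hmem
  refine ⟨j, ?_⟩
  rw [← Submodule.Quotient.eq, Submodule.Quotient.mk_smul]
  exact hj.symm

/-- Since μ generates D, integrality of m·B(μ,μ) makes mμ pair integrally with everything, so mμ is
zero in D. -/
lemma card_dvd_of_mul_pairing_mem {μ : Fin n → ℤ}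
    (hμ : addOrderOf (Submodule.Quotient.mk μ : T.discGroup) = Nat.card T.discGroup)
    {m : ℤ} (hm : (m : ℚ) * T.pairing μ μ ∈ ratInt) : (Nat.card T.discGroup : ℤ) ∣ m := by
  rw [← hμ, addOrderOf_dvd_iff_zsmul_eq_zero, ← Submodule.Quotient.mk_smul,
    Submodule.Quotient.mk_eq_zero]
  refine T.mem_lattice_of_pairing_mem _ fun ν => ?_
  obtain ⟨j, hj⟩ := T.exists_zsmul_sub_mem hμ ν
  have h1 : ν = j • μ + (ν - j • μ) := by abel
  rw [h1, pairing_add_right]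
  refine add_mem ?_ (T.pairing_mem_of_mem _ hj)
  rw [pairing_zsmul_right, pairing_zsmul_left]
  exact intCast_mul_mem_ratInt _ hm

variable {T} in
lemma IsFundamental.den_invValue (hT : T.IsFundamental) {μ : Fin n → ℤ}
    (hμ : addOrderOf (Submodule.Quotient.mk μ : T.discGroup) = Nat.card T.discGroup) :
    (invValue T.mat μ).den = T.level := by
  refine Nat.dvd_antisymm (den_dvd_of_mul_mem T.level_pos.ne' (hT.level_mul_invValue_mem μ)) ?_
  set m := (invValue T.mat μ).den with hm
  have hmem := den_mul_mem (invValue T.mat μ)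
  rw [← hm, invValue_eq] at hmem
  have h1 : (Nat.card T.discGroup : ℤ) ∣ m := by
    refine T.card_dvd_of_mul_pairing_mem hμ ?_
    convert add_mem hmem hmem using 1
    push_cast; ring
  by_cases hn : Even n
  · rw [level, if_pos hn]
    exact_mod_cast h1
  · rw [level, if_neg hn]
    obtain ⟨d, hd, -, -⟩ := hT
    -- For odd n, |D| is even, hence so is m = 2m'. As mQ(μ) = m'B(μ,μ), the divisibility applies to
    -- m' and yields the extra factor 2.
    have h2 : (2 : ℤ) ∣ m := (Dvd.intro _ (T.card_eq_of_not_even hd hn).symm).trans h1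
    obtain ⟨m', hm'⟩ := h2
    have h3 : (Nat.card T.discGroup : ℤ) ∣ m' := by
      refine T.card_dvd_of_mul_pairing_mem hμ ?_
      convert hmem using 1
      have : (m : ℚ) = 2 * m' := by exact_mod_cast hm'
      rw [this]; ring
    have h4 : (2 * Nat.card T.discGroup : ℤ) ∣ m := hm' ▸ mul_dvd_mul_left 2 h3
    exact_mod_cast h4

variable {T} in
lemma IsFundamental.exists_generator (hT : T.IsFundamental) : ∃ μ : Fin n → ℤ,
    addOrderOf (Submodule.Quotient.mk μ : T.discGroup) = Nat.card T.discGroup := by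
  have := isAddCyclic_of_squarefree_card hT.squarefree_card
  obtain ⟨γ, hγ⟩ := IsAddCyclic.exists_generator (α := T.discGroup)
  obtain ⟨μ, rfl⟩ := Submodule.Quotient.mk_surjective _ γ
  exact ⟨μ, addOrderOf_eq_card_of_forall_mem_zmultiples hγ⟩

variable {T} in
lemma IsFundamental.hasMaxDenominator (hT : T.IsFundamental) {μ : Fin n → ℤ}
    (hμ : addOrderOf (Submodule.Quotient.mk μ : T.discGroup) = Nat.card T.discGroup) :
    HasMaxDenominator T.mat μ := by
  intro ν
  rw [hT.den_invValue hμ]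
  exact Nat.le_of_dvd T.level_pos
    (den_dvd_of_mul_mem T.level_pos.ne' (hT.level_mul_invValue_mem ν))

variable {T} in
lemma IsFundamental.den_eq_level (hT : T.IsFundamental) {μ : Fin n → ℤ}
    (hμ : HasMaxDenominator T.mat μ) : (invValue T.mat μ).den = T.level := by
  obtain ⟨γ, hγ⟩ := hT.exists_generator
  refine le_antisymm (Nat.le_of_dvd T.level_pos
    (den_dvd_of_mul_mem T.level_pos.ne' (hT.level_mul_invValue_mem μ))) ?_
  rw [← hT.den_invValue hγ]
  exact hμ γ

variable {T} in
/-- The value of `N T⁻¹[μ/2]` modulo `1` determines the torsion of the class of `μ`. -/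
lemma IsFundamental.nsmul_eq_zero_of_invValue (hT : T.IsFundamental) {N : ℕ}
    (hcop : IsCoprime (T.level : ℤ) (N : ℤ)) {μ ν : Fin n → ℤ}
    (h : (N : ℚ) * (invValue T.mat μ - invValue T.mat ν) ∈ ratInt)
    {a b : ℕ} (hab : a * b = Nat.card T.discGroup)
    (ha : a • (Submodule.Quotient.mk μ : T.discGroup) = 0) :
    a • (Submodule.Quotient.mk ν : T.discGroup) = 0 := by
  -- The level and N both carry the difference into ℤ; a Bézout relation then gives the difference
  -- itself.
  have hq : invValue T.mat μ - invValue T.mat ν ∈ ratInt := by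
    obtain ⟨s, t, hst⟩ := hcop
    have h1 : (T.level : ℚ) * (invValue T.mat μ - invValue T.mat ν) ∈ ratInt := by
      rw [mul_sub]
      exact sub_mem (hT.level_mul_invValue_mem μ) (hT.level_mul_invValue_mem ν)
    have h2 := add_mem (intCast_mul_mem_ratInt s h1) (intCast_mul_mem_ratInt t h)
    convert h2 using 1
    have : (s * T.level + t * N : ℚ) = 1 := by exact_mod_cast hst
    rw [← mul_assoc, ← mul_assoc, ← add_mul, this, one_mul]
  obtain ⟨γ, hγ⟩ := hT.exists_generator
  obtain ⟨k, hk⟩ := T.exists_zsmul_sub_mem hγ μ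
  obtain ⟨l, hl⟩ := T.exists_zsmul_sub_mem hγ ν
  -- Writing μ ≡ kγ and ν ≡ lγ, equality of Q modulo 1 says that (k² - l²)B(γ,γ)/2 is integral.
  have hkl : (Nat.card T.discGroup : ℤ) ∣ k ^ 2 - l ^ 2 := by
    refine T.card_dvd_of_mul_pairing_mem hγ ?_
    have h1 := T.invValue_sub_mem hk
    have h2 := T.invValue_sub_mem hl
    rw [invValue_zsmul, T.invValue_eq γ] at h1 h2
    have h3 := sub_mem hq (sub_mem h1 h2)
    convert add_mem h3 h3 using 1
    push_cast; ring
  have hkey : ∀ (c : ℤ) (ρ : Fin n → ℤ), ρ - c • γ ∈ T.lattice →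
      (a • (Submodule.Quotient.mk ρ : T.discGroup) = 0 ↔ (b : ℤ) ∣ c) := by
    intro c ρ hρ
    rw [← Submodule.Quotient.eq, Submodule.Quotient.mk_smul] at hρ
    have ha0 : (a : ℤ) ≠ 0 := by
      have : 0 < Nat.card T.discGroup := Nat.card_pos
      rintro h0
      have : a = 0 := by exact_mod_cast h0
      rw [this, zero_mul] at hab
      omega
    rw [hρ, ← natCast_zsmul, ← mul_smul, ← addOrderOf_dvd_iff_zsmul_eq_zero, hγ, ← hab]
    push_cast
    exact mul_dvd_mul_iff_left ha0
  rw [hkey l ν hl]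
  rw [hkey k μ hk] at ha
  have hbsq : Squarefree (b : ℤ) := by
    rw [Int.squarefree_natCast]
    exact hT.squarefree_card.squarefree_of_dvd (hab ▸ Dvd.intro_left _ rfl)
  have hb : (b : ℤ) ∣ Nat.card T.discGroup := by rw [← hab]; push_cast; exact Dvd.intro_left _ rfl
  -- For squarefree b, divisibility of l by b can be tested on l², which is congruent to k² modulo
  -- b.
  rw [← hbsq.dvd_pow_iff_dvd (n := 2) two_ne_zero]
  have := dvd_sub (dvd_pow ha two_ne_zero) (hb.trans hkl)
  simpa using this

/-- The character `ν ↦ e(ᵗμ (2T)⁻¹ ν)` of the discriminant group. -/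
noncomputable def discChar (μ : T.discGroup) : AddChar T.discGroup ℂ where
  toFun ν := e (T.pairing (Quotient.out μ) (Quotient.out ν) : ℚ)
  map_zero_eq_one' := by
    rw [e_ratCast_eq_one_iff]
    refine T.pairing_mem_of_mem _ ?_
    rw [← Submodule.Quotient.mk_eq_zero]
    exact Quotient.out_eq _
  map_add_eq_mul' := by
    intro x y
    rw [← e_add, ← Rat.cast_add, e_ratCast_eq_iff, ← pairing_add_right, sub_eq_add_neg,
      ← neg_one_mul (T.pairing _ (_ + _))]
    have h : ((-1 : ℤ) : ℚ) = -1 := by norm_num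
    rw [← h, ← pairing_zsmul_right, ← pairing_add_right]
    refine T.pairing_mem_of_mem _ ?_
    rw [neg_one_zsmul, ← sub_eq_add_neg, ← Submodule.Quotient.eq, Submodule.Quotient.mk_add]
    have hout : ∀ z : T.discGroup, (Submodule.Quotient.mk (Quotient.out z) : T.discGroup) = z :=
      fun z => Quotient.out_eq z
    rw [hout, hout, hout]

lemma discChar_apply (μ ν : T.discGroup) :
    T.discChar μ ν = e (T.pairing (Quotient.out μ) (Quotient.out ν) : ℚ) := rfl

lemma mk_out (z : T.discGroup) : (Submodule.Quotient.mk (Quotient.out z) : T.discGroup) = z :=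
  Quotient.out_eq z

lemma discChar_comm (μ ν : T.discGroup) : T.discChar μ ν = T.discChar ν μ := by
  rw [discChar_apply, discChar_apply, pairing_comm]

lemma pairing_sub_mem {μ μ' : Fin n → ℤ} (h : μ - μ' ∈ T.lattice) (ν : Fin n → ℤ) :
    T.pairing μ ν - T.pairing μ' ν ∈ ratInt := by
  have h1 : T.pairing μ ν = T.pairing μ' ν + T.pairing ν (μ - μ') := by
    rw [T.pairing_comm ν, ← pairing_add_left, add_sub_cancel]
  rw [h1, add_sub_cancel_left]
  exact T.pairing_mem_of_mem _ h

lemma discChar_mk (μ ν : Fin n → ℤ) :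
    T.discChar (Submodule.Quotient.mk μ) (Submodule.Quotient.mk ν) = e (T.pairing μ ν : ℚ) := by
  have h : ∀ ρ : Fin n → ℤ,
      Quotient.out (Submodule.Quotient.mk ρ : T.discGroup) - ρ ∈ T.lattice := fun ρ => by
    rw [← Submodule.Quotient.eq, mk_out]
  rw [discChar_apply, e_ratCast_eq_iff]
  have h1 := T.pairing_sub_mem (h μ) (Quotient.out (Submodule.Quotient.mk ν : T.discGroup))
  have h2 := T.pairing_sub_mem (h ν) μ
  rw [pairing_comm, T.pairing_comm ν μ] at h2
  convert add_mem h1 h2 using 1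
  ring

lemma eq_zero_of_discChar_eq_one (μ : T.discGroup) (h : ∀ ν, T.discChar μ ν = 1) : μ = 0 := by
  obtain ⟨μ, rfl⟩ := Submodule.Quotient.mk_surjective _ μ
  rw [Submodule.Quotient.mk_eq_zero]
  refine T.mem_lattice_of_pairing_mem _ fun ν => ?_
  rw [← e_ratCast_eq_one_iff, ← discChar_mk]
  exact h _

end PosHalfIntegral

end JacobiForms

/-! ### Uniqueness of Fourier coefficients on the torus -/

namespace JacobiForms

lemma hasSum_of_eq {ι : Type*} {f g : ι → ℂ} {a : ℂ} (h : HasSum f a) (hfg : ∀ i, g i = f i) :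
    HasSum g a :=
  funext hfg ▸ h

section FourierUniqueness

open UnitAddTorus MeasureTheory

noncomputable local instance haarUnitAddCircle : MeasureSpace UnitAddCircle :=
  ⟨AddCircle.haarAddCircle⟩

local instance isProbabilityMeasure_haarUnitAddCircle :
    IsProbabilityMeasure (volume : Measure UnitAddCircle) :=
  inferInstanceAs (IsProbabilityMeasure AddCircle.haarAddCircle)

lemma mFourier_coe {n : ℕ} (r : Fin n → ℤ) (x : Fin n → ℝ) :
    mFourier r (fun i => (x i : UnitAddCircle)) = e (∑ i, (r i : ℂ) * (x i : ℂ)) := by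
  rw [e, Finset.mul_sum, Complex.exp_sum]
  simp only [mFourier, ContinuousMap.coe_mk, fourier_coe_apply]
  refine Finset.prod_congr rfl fun i _ => ?_
  congr 1
  push_cast
  ring

/-- The coefficients of an absolutely convergent Fourier series are unique. -/
lemma fourier_coeff_eq_zero {n : ℕ} {a : (Fin n → ℤ) → ℂ}
    (h : ∀ x : Fin n → ℝ, HasSum (fun r => a r * e (∑ i, (r i : ℂ) * (x i : ℂ))) 0) :
    a = 0 := by
  -- At x = 0 every exponential is 1, so convergence there already gives absolute summability, hence
  -- uniform convergence on the torus.
  have ha : Summable (fun r => ‖a r‖) := by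
    have := (h 0).summable.norm
    simpa [e_zero] using this
  have hF : Summable (fun r => a r • mFourier (d := Fin n) r) := by
    refine Summable.of_norm ?_
    simpa [norm_smul, mFourier_norm] using ha
  have hF0 : ∑' r, a r • mFourier (d := Fin n) r = 0 := by
    ext y
    obtain ⟨x, rfl⟩ : ∃ x : Fin n → ℝ, y = fun i => (x i : UnitAddCircle) := by
      choose x hx using fun i => QuotientAddGroup.mk_surjective (y i)
      exact ⟨x, funext fun i => (hx i).symm⟩
    have h1 := (ContinuousMap.evalCLM ℂ (fun i => (x i : UnitAddCircle))).hasSum hF.hasSum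
    refine h1.unique (hasSum_of_eq (h x) fun r => ?_)
    rw [← mFourier_coe]
    simp
  have hsum := hF.hasSum
  rw [hF0] at hsum
  ext s
  -- In L² the characters are orthonormal, so the inner product with the s-th one isolates `a s`.
  have h2 := (ContinuousMap.toLp (E := ℂ) 2 (volume : Measure (UnitAddTorus (Fin n))) ℂ).hasSum hsum
  rw [map_zero] at h2
  have h3 := (innerSL ℂ (mFourierLp (d := Fin n) 2 s)).hasSum h2
  rw [map_zero] at h3
  refine HasSum.unique (f := fun r => if r = s then a s else 0) (hasSum_ite_eq s (a s))
    (hasSum_of_eq h3 fun r => ?_)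
  have horth := orthonormal_iff_ite.mp (orthonormal_mFourier (d := Fin n)) s r
  simp only [map_smul, innerSL_apply_apply]
  rw [horth]
  by_cases hrs : r = s
  · simp [hrs]
  · simp [hrs, Ne.symm hrs]

end FourierUniqueness

/-! ### Convergence of Gaussian sums -/

section Gaussian

lemma summable_prod_pi {n : ℕ} (f : Fin n → ℤ → ℝ) (h0 : ∀ i m, 0 ≤ f i m)
    (hf : ∀ i, Summable (f i)) : Summable (fun r : Fin n → ℤ => ∏ i, f i (r i)) := by
  induction n with
  | zero => exact Summable.of_finite
  | succ n ih =>
    rw [← (Fin.consEquiv (fun _ : Fin (n + 1) => ℤ)).summable_iff]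
    have h1 := (hf 0).mul_of_nonneg (ih (fun i => f i.succ) (fun i => h0 _) (fun i => hf _))
      (h0 0) (fun r => Finset.prod_nonneg fun i _ => h0 _ _)
    convert h1 using 2 with p
    simp [Fin.consEquiv, Fin.prod_univ_succ]

lemma summable_exp_quadratic {c : ℝ} (hc : 0 < c) (w : ℝ) :
    Summable (fun m : ℤ => Real.exp (-(2 * Real.pi * (c * m ^ 2 + w * m)))) := by
  have h := ((summable_jacobiTheta₂_term_iff ((w : ℂ) * Complex.I)
    ((2 * c : ℝ) * Complex.I)).mpr (by simpa using hc)).norm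
  refine h.congr fun m => ?_
  rw [norm_jacobiTheta₂_term]
  congr 1
  simp
  ring

/-- The form has a positive minimum on the compact unit sphere of the sup norm, and homogeneity
extends the bound. -/
lemma exists_pos_mul_sum_sq_le {n : ℕ} {B : Matrix (Fin n) (Fin n) ℝ} (hB : B.PosDef) :
    ∃ c : ℝ, 0 < c ∧ ∀ x : Fin n → ℝ, c * ∑ i, x i ^ 2 ≤ x ⬝ᵥ (B *ᵥ x) := by
  have hpos : ∀ x : Fin n → ℝ, x ≠ 0 → 0 < x ⬝ᵥ (B *ᵥ x) := fun x hx => by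
    simpa using hB.dotProduct_mulVec_pos hx
  have hcont : Continuous (fun x : Fin n → ℝ => x ⬝ᵥ (B *ᵥ x)) := by
    simp only [dotProduct, Matrix.mulVec]
    fun_prop
  obtain ⟨c, hc, hcs⟩ : ∃ c : ℝ, 0 < c ∧
      ∀ x ∈ Metric.sphere (0 : Fin n → ℝ) 1, c ≤ x ⬝ᵥ (B *ᵥ x) := by
    -- The sphere is empty when n = 0.
    rcases (Metric.sphere (0 : Fin n → ℝ) 1).eq_empty_or_nonempty with he | hne
    · exact ⟨1, one_pos, by simp [he]⟩
    · obtain ⟨y, hy, hmin⟩ := (isCompact_sphere (0 : Fin n → ℝ) 1).exists_isMinOn hne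
        hcont.continuousOn
      refine ⟨_, hpos y ?_, fun x hx => hmin hx⟩
      rintro rfl
      simp at hy
  -- The sum of squares is at most n‖x‖²; n + 1 keeps the denominator nonzero for n = 0.
  refine ⟨c / (n + 1), by positivity, fun x => ?_⟩
  by_cases hx : x = 0
  · simp [hx]
  have hnx : 0 < ‖x‖ := norm_pos_iff.mpr hx
  have h1 := hcs (‖x‖⁻¹ • x) (by simp [norm_smul, hnx.ne'])
  rw [Matrix.mulVec_smul, dotProduct_smul, smul_dotProduct, smul_eq_mul, smul_eq_mul] at h1
  have h2 : c * ‖x‖ ^ 2 ≤ x ⬝ᵥ (B *ᵥ x) := by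
    have h3 := mul_le_mul_of_nonneg_right h1 (sq_nonneg ‖x‖)
    refine h3.trans_eq ?_
    field_simp
  have h4 : ∑ i, x i ^ 2 ≤ n * ‖x‖ ^ 2 := by
    have : ∀ i ∈ Finset.univ, x i ^ 2 ≤ ‖x‖ ^ 2 := fun i _ => by
      rw [← sq_abs, ← Real.norm_eq_abs]
      gcongr
      exact norm_le_pi_norm x i
    simpa using Finset.sum_le_card_nsmul _ _ _ this
  refine le_trans ?_ h2
  rw [div_mul_eq_mul_div, div_le_iff₀ (by positivity), mul_assoc]
  refine mul_le_mul_of_nonneg_left (h4.trans ?_) hc.le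
  nlinarith [sq_nonneg ‖x‖]

end Gaussian

/-! ### Theta series and the theta decomposition at a fixed τ -/

namespace PosHalfIntegral

variable {n : ℕ} (T : PosHalfIntegral n)

lemma exists_pos_mul_sum_sq_le_invValue :
    ∃ c : ℝ, 0 < c ∧ ∀ r : Fin n → ℤ, c * ∑ i, (r i : ℝ) ^ 2 ≤ (invValue T.mat r : ℝ) := by
  obtain ⟨c, hc, h⟩ := exists_pos_mul_sum_sq_le T.posDef.inv
  refine ⟨c / 4, by positivity, fun r => ?_⟩
  have hinv : (T.mat.map (fun q : ℚ => (q : ℝ)))⁻¹ = T.mat⁻¹.map (fun q : ℚ => (q : ℝ)) := by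
    apply Matrix.inv_eq_right_inv
    have hdet : IsUnit T.mat.det := by
      have := T.det_ne_zero
      rw [Matrix.det_smul] at this
      exact (right_ne_zero_of_mul this).isUnit
    change (Rat.castHom ℝ).mapMatrix _ * (Rat.castHom ℝ).mapMatrix _ = 1
    rw [← map_mul, Matrix.mul_nonsing_inv _ hdet, map_one]
  have h1 := h (fun i => (r i : ℝ) / 2)
  rw [hinv] at h1
  convert h1 using 1
  · rw [Finset.mul_sum, Finset.mul_sum]
    exact Finset.sum_congr rfl fun i _ => by ring
  · simp [invValue, dotProduct, Matrix.mulVec]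

/-- The exponential `e(T⁻¹[r/2] τ + ᵗr z)`. -/
noncomputable def thetaTerm (τ : ℍ) (z : Fin n → ℂ) (r : Fin n → ℤ) : ℂ :=
  e ((invValue T.mat r : ℂ) * τ + ∑ i, (r i : ℂ) * z i)

/-- The lower bound on T⁻¹[r/2] dominates the terms by products of one-dimensional Gaussians. -/
lemma summable_thetaTerm (τ : ℍ) (z : Fin n → ℂ) : Summable (T.thetaTerm τ z) := by
  obtain ⟨c, hc, h⟩ := T.exists_pos_mul_sum_sq_le_invValue
  have hs := summable_prod_pi
    (fun i (m : ℤ) => Real.exp (-(2 * Real.pi * (c * τ.im * m ^ 2 + (z i).im * m))))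
    (fun i m => (Real.exp_pos _).le)
    (fun i => summable_exp_quadratic (mul_pos hc τ.im_pos) (z i).im)
  refine Summable.of_norm_bounded hs fun r => ?_
  rw [thetaTerm, e, Complex.norm_exp, ← Real.exp_sum, Real.exp_le_exp]
  have him : (2 * Real.pi * Complex.I *
      ((invValue T.mat r : ℂ) * τ + ∑ i, (r i : ℂ) * z i)).re =
      -(2 * Real.pi * ((invValue T.mat r : ℝ) * τ.im + ∑ i, (z i).im * r i)) := by
    have h1 : ((invValue T.mat r : ℂ)) = (((invValue T.mat r : ℚ) : ℝ) : ℂ) := by push_cast; rfl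
    have h2 : (((invValue T.mat r : ℂ) * τ + ∑ i, (r i : ℂ) * z i)).im =
        (invValue T.mat r : ℝ) * τ.im + ∑ i, (z i).im * r i := by
      rw [Complex.add_im, h1, Complex.im_ofReal_mul, Complex.im_sum]
      congr 1
      refine Finset.sum_congr rfl fun i _ => ?_
      rw [← Complex.ofReal_intCast, Complex.im_ofReal_mul, mul_comm]
    rw [← h2, mul_right_comm, ← Complex.ofReal_ofNat, ← Complex.ofReal_mul, mul_assoc,
      Complex.re_ofReal_mul, Complex.mul_I_re, mul_neg]
  rw [him, Finset.sum_neg_distrib, ← Finset.mul_sum, neg_le_neg_iff, Finset.sum_add_distrib,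
    ← Finset.mul_sum]
  refine mul_le_mul_of_nonneg_left ?_ (by positivity)
  have := mul_le_mul_of_nonneg_right (h r) τ.im_pos.le
  linarith

/-- `(2T)⁻¹ r` as a complex vector. -/
noncomputable def ctilde (r : Fin n → ℤ) : Fin n → ℂ := fun i => ((tilde T.mat r i : ℚ) : ℂ)

lemma mulVec_ctilde (r : Fin n → ℤ) :
    T.mat.map (fun q : ℚ => (q : ℂ)) *ᵥ T.ctilde r = fun i => (r i : ℂ) / 2 := by
  have h : T.mat *ᵥ tilde T.mat r = fun i => (r i : ℚ) / 2 := by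
    have h1 : ((2 : ℚ) • T.mat) *ᵥ tilde T.mat r = fun i => (r i : ℚ) := by
      rw [tilde, Matrix.mulVec_mulVec, Matrix.mul_nonsing_inv _ T.det_ne_zero.isUnit,
        Matrix.one_mulVec]
    ext i
    have h2 := congrFun h1 i
    rw [Matrix.smul_mulVec, Pi.smul_apply, smul_eq_mul] at h2
    linarith
  ext i
  have h3 := congrArg (fun q : ℚ => (q : ℂ)) (congrFun h i)
  simpa [Matrix.mulVec, dotProduct, ctilde] using h3

lemma bil_comm (x y : Fin n → ℂ) : bil T.mat x y = bil T.mat y x := by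
  have h : (T.mat.map (fun q : ℚ => (q : ℂ)))ᵀ = T.mat.map (fun q : ℚ => (q : ℂ)) := by
    rw [← Matrix.transpose_map, T.symm]
  rw [bil, bil, Matrix.dotProduct_mulVec, ← Matrix.mulVec_transpose, h, dotProduct_comm]

lemma bil_add_right (x y z : Fin n → ℂ) :
    bil T.mat x (y + z) = bil T.mat x y + bil T.mat x z := by
  rw [bil, Matrix.mulVec_add, dotProduct_add]; rfl

lemma bil_smul_right (c : ℂ) (x y : Fin n → ℂ) :
    bil T.mat x (c • y) = c * bil T.mat x y := by
  rw [bil, Matrix.mulVec_smul, dotProduct_smul]; rfl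

lemma two_mul_bil_ctilde (r : Fin n → ℤ) (z : Fin n → ℂ) :
    2 * bil T.mat (T.ctilde r) z = ∑ i, (r i : ℂ) * z i := by
  rw [bil_comm, bil, mulVec_ctilde, dotProduct, Finset.mul_sum]
  exact Finset.sum_congr rfl fun i _ => by ring

lemma sum_mul_ctilde (r s : Fin n → ℤ) :
    ∑ i, (r i : ℂ) * T.ctilde s i = ((T.pairing r s : ℚ) : ℂ) := by
  simp [pairing, dotProduct, ctilde, tilde]

lemma bil_ctilde_self (r : Fin n → ℤ) :
    bil T.mat (T.ctilde r) (T.ctilde r) = (invValue T.mat r : ℂ) := by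
  have h := T.two_mul_bil_ctilde r (T.ctilde r)
  rw [sum_mul_ctilde] at h
  rw [invValue_eq]
  push_cast
  linear_combination h / 2

lemma ctilde_add_gram (m l : Fin n → ℤ) :
    T.ctilde (m + T.gram *ᵥ l) = fun i => (l i : ℂ) + T.ctilde m i := by
  have h : tilde T.mat (m + T.gram *ᵥ l) = (fun i => (l i : ℚ)) + tilde T.mat m := by
    have h1 : (fun i => ((m + T.gram *ᵥ l) i : ℚ)) =
        (fun i => (m i : ℚ)) + ((2 : ℚ) • T.mat) *ᵥ (fun i => (l i : ℚ)) := by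
      rw [← gram_map_mulVec]; ext i; simp
    rw [tilde, h1, Matrix.mulVec_add, Matrix.mulVec_mulVec,
      Matrix.nonsing_inv_mul _ T.det_ne_zero.isUnit, Matrix.one_mulVec, add_comm]
    rfl
  ext i
  rw [ctilde, h]
  simp [ctilde]

lemma ctilde_gram (l : Fin n → ℤ) : T.ctilde (T.gram *ᵥ l) = fun i => (l i : ℂ) := by
  have h0 : T.ctilde 0 = 0 := by
    ext i
    have : (fun j => ((0 : Fin n → ℤ) j : ℚ)) = 0 := by ext j; simp
    rw [ctilde, tilde, this, Matrix.mulVec_zero]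
    simp
  have := T.ctilde_add_gram 0 l
  rw [zero_add, h0] at this
  simpa using this

lemma gram_mulVec_injective : Function.Injective (fun v : Fin n → ℤ => T.gram *ᵥ v) := by
  intro v w h
  have h1 : (fun i => (v i : ℂ)) = fun i => (w i : ℂ) := by
    rw [← ctilde_gram, ← ctilde_gram]
    exact congrArg T.ctilde h
  ext i
  exact_mod_cast congrFun h1 i

open Classical in
-- The substitution r = m + 2Tl turns each theta series into the part of one series over ℤⁿ lying in
-- a single class, so that theta sums become Fourier series in z.
lemma hasSum_thetaClass (μ : T.discGroup) (τ : ℍ) (z : Fin n → ℂ) :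
    HasSum (fun r : Fin n → ℤ => if (Submodule.Quotient.mk r : T.discGroup) = μ
      then T.thetaTerm τ z r else 0) (T.thetaClass μ τ z) := by
  obtain ⟨m, rfl⟩ := Submodule.Quotient.mk_surjective _ μ
  have hinj : Function.Injective (fun l : Fin n → ℤ => m + T.gram *ᵥ l) := fun v w h =>
    T.gram_mulVec_injective (add_left_cancel h)
  rw [← hinj.hasSum_iff]
  · have hmem : ∀ l, (Submodule.Quotient.mk (m + T.gram *ᵥ l) : T.discGroup) =
        Submodule.Quotient.mk m := fun l => by
      rw [Submodule.Quotient.eq, add_sub_cancel_left, mem_lattice_iff]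
      exact ⟨l, rfl⟩
    have hfun : ((fun r : Fin n → ℤ => if (Submodule.Quotient.mk r : T.discGroup) =
        Submodule.Quotient.mk m then T.thetaTerm τ z r else 0) ∘ fun l => m + T.gram *ᵥ l) =
        T.thetaTerm τ z ∘ fun l => m + T.gram *ᵥ l := by
      ext l
      simp only [Function.comp_apply]
      rw [if_pos (hmem l)]
    rw [hfun]
    have hs := ((T.summable_thetaTerm τ z).comp_injective hinj).hasSum
    have hval : T.thetaClass (Submodule.Quotient.mk m) τ z =
        ∑' l, (T.thetaTerm τ z ∘ fun l => m + T.gram *ᵥ l) l := ?_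
    · rwa [hval]
    change theta T.mat m τ z = _
    unfold theta
    refine tsum_congr fun l => ?_
    have hx : (fun i => (l i : ℂ) + ((tilde T.mat m i : ℚ) : ℂ)) =
        T.ctilde (m + T.gram *ᵥ l) := (T.ctilde_add_gram m l).symm
    simp only [Function.comp_apply, hx, thetaTerm]
    rw [bil_ctilde_self, two_mul_bil_ctilde]
  · intro r hr
    refine if_neg fun h => hr ?_
    rw [Submodule.Quotient.eq, mem_lattice_iff] at h
    obtain ⟨v, hv⟩ := h
    exact ⟨v, by simp [← hv]⟩

/-- The combination `∑_μ u_μ Θ_{μ,T}` of theta series. -/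
noncomputable def thetaSum (u : T.discGroup → ℂ) (τ : ℍ) (z : Fin n → ℂ) : ℂ :=
  ∑ μ, u μ * T.thetaClass μ τ z

lemma hasSum_thetaSum (u : T.discGroup → ℂ) (τ : ℍ) (z : Fin n → ℂ) :
    HasSum (fun r : Fin n → ℤ => u (Submodule.Quotient.mk r) * T.thetaTerm τ z r)
      (T.thetaSum u τ z) := by
  classical
  have h := hasSum_sum (s := Finset.univ) fun μ _ => (T.hasSum_thetaClass μ τ z).mul_left (u μ)
  refine hasSum_of_eq h fun r => ?_
  simp

lemma thetaTerm_eq (τ : ℍ) (z : Fin n → ℂ) (r : Fin n → ℤ) :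
    T.thetaTerm τ z r = e ((invValue T.mat r : ℂ) * τ) * e (∑ i, (r i : ℂ) * z i) := by
  rw [thetaTerm, e_add]

/-- The r-th Fourier coefficient is the component at the class of r times a nonvanishing
exponential. -/
lemma thetaSum_injective {τ : ℍ} {u u' : T.discGroup → ℂ}
    (h : ∀ z, T.thetaSum u τ z = T.thetaSum u' τ z) : u = u' := by
  have h0 := fourier_coeff_eq_zero (n := n) (a := fun r =>
    (u (Submodule.Quotient.mk r) - u' (Submodule.Quotient.mk r)) *
      e ((invValue T.mat r : ℂ) * τ)) (fun x => by
    have h1 := (T.hasSum_thetaSum u τ (fun i => (x i : ℂ))).sub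
      (T.hasSum_thetaSum u' τ (fun i => (x i : ℂ)))
    rw [h, sub_self] at h1
    refine hasSum_of_eq h1 fun r => ?_
    rw [thetaTerm_eq]
    ring)
  ext μ
  obtain ⟨m, rfl⟩ := Submodule.Quotient.mk_surjective _ μ
  have := congrFun h0 m
  simp only [Pi.zero_apply, mul_eq_zero, e_ne_zero, or_false] at this
  exact sub_eq_zero.mp this

/-- A function with a Fourier expansion that satisfies the elliptic transformation law is a
combination of theta series. -/
lemma exists_thetaSum_eq (τ : ℍ) (f : (Fin n → ℂ) → ℂ) (a : (Fin n → ℤ) → ℂ)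
    (hf : ∀ z, HasSum (fun r => a r * e (∑ i, (r i : ℂ) * z i)) (f z))
    (hell : ∀ (x : Fin n → ℤ) z, f (fun i => z i + (x i : ℂ) * (τ : ℂ)) =
      e (-(bil T.mat (fun i => (x i : ℂ)) (fun i => (x i : ℂ)) * (τ : ℂ)
        + 2 * bil T.mat (fun i => (x i : ℂ)) z)) * f z) :
    ∃ u : T.discGroup → ℂ, ∀ z, f z = T.thetaSum u τ z := by
  -- Comparison of the r-th Fourier coefficients on both sides of the elliptic law for z ↦ z + xτ.
  have hstep : ∀ x r : Fin n → ℤ, a (r + T.gram *ᵥ x) * e (-((invValue T.mat (T.gram *ᵥ x) : ℂ) * τ))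
      = a r * e (((r ⬝ᵥ x : ℤ) : ℂ) * τ) := by
    intro x
    have h0 := fourier_coeff_eq_zero (n := n) (a := fun r => a (r + T.gram *ᵥ x) *
      e (-((invValue T.mat (T.gram *ᵥ x) : ℂ) * τ)) - a r * e (((r ⬝ᵥ x : ℤ) : ℂ) * τ)) (fun y => by
      set z : Fin n → ℂ := fun i => (y i : ℂ)
      have h1 := hf (fun i => z i + (x i : ℂ) * (τ : ℂ))
      rw [hell x z, ← ctilde_gram, bil_ctilde_self, two_mul_bil_ctilde] at h1
      have h2 := (hf z).mul_left (e (-((invValue T.mat (T.gram *ᵥ x) : ℂ) * τ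
        + ∑ i, ((T.gram *ᵥ x) i : ℂ) * z i)))
      rw [← (Equiv.addRight (T.gram *ᵥ x)).hasSum_iff] at h2
      have h3 := h2.sub h1
      rw [sub_self] at h3
      refine hasSum_of_eq h3 fun r => ?_
      have e1 : ∑ i, (r i : ℂ) * (z i + (x i : ℂ) * (τ : ℂ)) =
          ∑ i, (r i : ℂ) * z i + ((r ⬝ᵥ x : ℤ) : ℂ) * τ := by
        simp only [mul_add, Finset.sum_add_distrib, dotProduct, Int.cast_sum, Int.cast_mul,
          Finset.sum_mul, mul_assoc]
      have e2 : ∑ i, ((r + T.gram *ᵥ x) i : ℂ) * z i =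
          ∑ i, (r i : ℂ) * z i + ∑ i, ((T.gram *ᵥ x) i : ℂ) * z i := by
        simp only [Pi.add_apply, Int.cast_add, add_mul, Finset.sum_add_distrib]
      simp only [Function.comp_apply, Equiv.coe_addRight]
      change _ * e (∑ i, (r i : ℂ) * z i) = _
      rw [e1, e2, neg_add, e_add, e_add, e_add, e_neg (∑ i, _)]
      have := e_ne_zero (∑ i, ((T.gram *ᵥ x) i : ℂ) * z i)
      field_simp)
    intro r
    exact sub_eq_zero.mp (congrFun h0 r)
  -- The normalised coefficient depends only on the class of r, since T⁻¹[(s + 2Tx)/2] = T⁻¹[s/2] +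
  -- T[x] + ᵗsx; it is the theta component.
  set A : (Fin n → ℤ) → ℂ := fun r => a r * e (-((invValue T.mat r : ℂ) * τ)) with hA
  have hinv : ∀ r s, r - s ∈ T.lattice → A r = A s := by
    intro r s hrs
    obtain ⟨x, hx⟩ := (T.mem_lattice_iff _).mp hrs
    rw [sub_eq_iff_eq_add'] at hx
    subst hx
    simp only [hA]
    rw [invValue_add_gram]
    push_cast
    rw [add_mul, add_mul, neg_add, neg_add, e_add, e_add, e_neg (((s ⬝ᵥ x : ℤ) : ℂ) * τ)]
    have h1 := hstep x s
    have h2 := e_ne_zero (((s ⬝ᵥ x : ℤ) : ℂ) * τ)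
    generalize e (((s ⬝ᵥ x : ℤ) : ℂ) * τ) = p at h1 h2 ⊢
    generalize e (-((invValue T.mat (T.gram *ᵥ x) : ℂ) * τ)) = p' at h1 ⊢
    field_simp
    linear_combination e (-((invValue T.mat s : ℂ) * τ)) * h1
  refine ⟨fun μ => A (Quotient.out μ), fun z => ?_⟩
  refine (hf z).unique (hasSum_of_eq (T.hasSum_thetaSum _ τ z) fun r => ?_)
  have h1 : A (Quotient.out (Submodule.Quotient.mk r : T.discGroup)) = A r := by
    apply hinv
    rw [← Submodule.Quotient.eq, mk_out]
  rw [h1, thetaTerm_eq]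
  simp only [hA]
  rw [e_neg]
  have := e_ne_zero ((invValue T.mat r : ℂ) * τ)
  field_simp

/-- With `thetaSum_add_smul_ctilde`, this is the Heisenberg action on components: shifts by b̃ act
by characters, shifts by τb̃ by translation of the index. -/
lemma thetaSum_add_ctilde (u : T.discGroup → ℂ) (τ : ℍ) (z : Fin n → ℂ) (b : Fin n → ℤ) :
    T.thetaSum u τ (z + T.ctilde b) =
      T.thetaSum (fun μ => u μ * T.discChar μ (Submodule.Quotient.mk b)) τ z := by
  refine (T.hasSum_thetaSum u τ _).unique (hasSum_of_eq (T.hasSum_thetaSum _ τ z) fun r => ?_)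
  have h : ∑ i, (r i : ℂ) * (z + T.ctilde b) i = ∑ i, (r i : ℂ) * z i + (T.pairing r b : ℚ) := by
    rw [← sum_mul_ctilde, ← Finset.sum_add_distrib]
    exact Finset.sum_congr rfl fun i _ => by simp [mul_add]
  rw [discChar_mk, thetaTerm_eq, thetaTerm_eq, h, e_add]
  ring

lemma thetaSum_add_smul_ctilde (u : T.discGroup → ℂ) (τ : ℍ) (z : Fin n → ℂ) (b : Fin n → ℤ) :
    T.thetaSum u τ (z + (τ : ℂ) • T.ctilde b) =
      e (-((invValue T.mat b : ℂ) * τ + ∑ i, (b i : ℂ) * z i)) *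
        T.thetaSum (fun μ => u (μ - Submodule.Quotient.mk b)) τ z := by
  have h1 := (T.hasSum_thetaSum (fun μ => u (μ - Submodule.Quotient.mk b)) τ z).mul_left
    (e (-((invValue T.mat b : ℂ) * τ + ∑ i, (b i : ℂ) * z i)))
  rw [← (Equiv.addRight b).hasSum_iff] at h1
  refine (T.hasSum_thetaSum u τ _).unique (hasSum_of_eq h1 fun r => ?_)
  simp only [Function.comp_apply, Equiv.coe_addRight, Submodule.Quotient.mk_add,
    add_sub_cancel_right]
  rw [mul_left_comm]
  congr 1
  rw [thetaTerm, thetaTerm, ← e_add, invValue_add]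
  congr 1
  have h : ∑ i, (r i : ℂ) * (z + (τ : ℂ) • T.ctilde b) i =
      ∑ i, (r i : ℂ) * z i + τ * (T.pairing r b : ℚ) := by
    rw [← sum_mul_ctilde, Finset.mul_sum, ← Finset.sum_add_distrib]
    exact Finset.sum_congr rfl fun i _ => by simp; ring
  have h2 : ∑ i, ((r + b) i : ℂ) * z i = ∑ i, (r i : ℂ) * z i + ∑ i, (b i : ℂ) * z i := by
    simp only [Pi.add_apply, Int.cast_add, add_mul, Finset.sum_add_distrib]
  rw [h, h2]
  push_cast
  ring

end PosHalfIntegral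

end JacobiForms

/-! ### Inversion, translation by multiples of N, and the vanishing argument -/

namespace JacobiForms

namespace PosHalfIntegral

variable {n : ℕ} (T : PosHalfIntegral n)

lemma thetaSum_smul_left (c : ℂ) (u : T.discGroup → ℂ) (τ : ℍ) (z : Fin n → ℂ) :
    T.thetaSum (fun μ => c * u μ) τ z = c * T.thetaSum u τ z := by
  simp only [thetaSum, Finset.mul_sum, mul_assoc]

lemma thetaSum_sum {ι : Type*} (s : Finset ι) (u : ι → T.discGroup → ℂ) (τ : ℍ)
    (z : Fin n → ℂ) :
    T.thetaSum (fun μ => ∑ i ∈ s, u i μ) τ z = ∑ i ∈ s, T.thetaSum (u i) τ z := by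
  simp only [thetaSum, Finset.sum_mul]
  rw [Finset.sum_comm]

lemma thetaSum_zero (τ : ℍ) (z : Fin n → ℂ) : T.thetaSum (fun _ => 0) τ z = 0 := by
  simp [thetaSum]

lemma sum_discChar_mul_sub (u : T.discGroup → ℂ) (ν κ : T.discGroup) :
    ∑ b, T.discChar ν (-b) * u (κ - b) = T.discChar ν (-κ) * ∑ μ, T.discChar ν μ * u μ := by
  rw [← (Equiv.subLeft κ).sum_comp, Finset.mul_sum]
  refine Finset.sum_congr rfl fun μ _ => ?_
  rw [Equiv.subLeft_apply, sub_sub_cancel, ← mul_assoc, ← AddChar.map_add_eq_mul]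
  congr 2
  abel

lemma sum_discChar_mul_discChar (v : T.discGroup → ℂ) (ν : T.discGroup) :
    ∑ b, T.discChar ν (-b) * (v ν * T.discChar ν b) = Nat.card T.discGroup * v ν := by
  have h : ∀ b, T.discChar ν (-b) * (v ν * T.discChar ν b) = v ν := fun b => by
    rw [mul_left_comm, ← AddChar.map_add_eq_mul, neg_add_cancel, AddChar.map_zero_eq_one, mul_one]
  simp [h, Nat.card_eq_fintype_card]

lemma sum_discChar_mul_discChar_of_ne (v : T.discGroup → ℂ) {ν κ : T.discGroup} (h : κ ≠ ν) :
    ∑ b, T.discChar ν (-b) * (v κ * T.discChar κ b) = 0 := by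
  have hadd : ∀ x y b, T.discChar (x + y) b = T.discChar x b * T.discChar y b := fun x y b => by
    rw [discChar_comm, AddChar.map_add_eq_mul, T.discChar_comm b x, T.discChar_comm b y]
  have hneg : ∀ b, T.discChar ν (-b) = T.discChar (-ν) b := fun b => by
    rw [AddChar.map_neg_eq_inv, eq_comm]
    refine eq_inv_of_mul_eq_one_left ?_
    rw [← hadd, neg_add_cancel, discChar_comm, AddChar.map_zero_eq_one]
  have h1 : ∀ b, T.discChar ν (-b) * (v κ * T.discChar κ b) = v κ * T.discChar (κ - ν) b :=
    fun b => by rw [hneg, sub_eq_add_neg, hadd]; ring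
  simp_rw [h1]
  rw [← Finset.mul_sum, AddChar.sum_eq_zero_iff_ne_zero.mpr, mul_zero]
  intro h0
  refine h (sub_eq_zero.mp (T.eq_zero_of_discChar_eq_one _ fun b => ?_))
  rw [h0, AddChar.zero_apply]

lemma bil_add_smul_self_div {t : ℂ} (ht : t ≠ 0) (x z : Fin n → ℂ) :
    bil T.mat (z + t • x) (z + t • x) / t =
      bil T.mat z z / t + (bil T.mat x x * t + 2 * bil T.mat x z) := by
  have h1 : bil T.mat (z + t • x) z = bil T.mat z z + t * bil T.mat x z := by
    rw [bil_comm, bil_add_right, bil_smul_right, T.bil_comm z x]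
  have h2 : bil T.mat (z + t • x) x = bil T.mat x z + t * bil T.mat x x := by
    rw [bil_comm, bil_add_right, bil_smul_right]
  rw [bil_add_right, bil_smul_right, h1, h2]
  field_simp
  ring

/-- Under the inversion `τ ↦ -1/τ`, theta components are related by the Fourier transform of the
discriminant group, up to non-zero factors. -/
lemma fourier_component_eq_zero_iff {τ w : ℍ} {u v : T.discGroup → ℂ} {C : ℂ} (hC : C ≠ 0)
    (h : ∀ z, T.thetaSum u τ z =
      C * T.thetaSum v w (fun i => z i / τ) * e (-(bil T.mat z z / τ))) (ν : T.discGroup) :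
    ∑ μ, T.discChar ν μ * u μ = 0 ↔ v ν = 0 := by
  classical
  have hτ : (τ : ℂ) ≠ 0 := τ.ne_zero
  -- Replacing z by z + τb̃ translates the components at τ, while z/τ moves by b̃ and the components
  -- at w are twisted by a character; the exponential factors cancel.
  have hshift : ∀ (b : T.discGroup) z, T.thetaSum (fun μ => u (μ - b)) τ z =
      (C * e (-(bil T.mat z z / τ))) *
        T.thetaSum (fun μ => v μ * T.discChar μ b) w (fun i => z i / τ) := by
    intro b z
    obtain ⟨b, rfl⟩ := Submodule.Quotient.mk_surjective _ b
    have h1 := h (z + (τ : ℂ) • T.ctilde b)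
    have hz : (fun i => (z + (τ : ℂ) • T.ctilde b) i / (τ : ℂ)) =
        (fun i => z i / (τ : ℂ)) + T.ctilde b := by
      ext i; simp; field_simp
    have hbil : bil T.mat (z + (τ : ℂ) • T.ctilde b) (z + (τ : ℂ) • T.ctilde b) / τ =
        bil T.mat z z / τ + ((invValue T.mat b : ℂ) * τ + ∑ i, (b i : ℂ) * z i) := by
      rw [T.bil_add_smul_self_div hτ, bil_ctilde_self, two_mul_bil_ctilde]
    rw [hz, hbil, thetaSum_add_smul_ctilde, thetaSum_add_ctilde,
      neg_add (bil T.mat z z / τ), e_add] at h1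
    have h2 := e_ne_zero (-((invValue T.mat b : ℂ) * τ + ∑ i, (b i : ℂ) * z i))
    apply mul_left_cancel₀ h2
    rw [h1]
    ring
  -- Summation over b against the inverse of the character of ν extracts the Fourier coefficient of
  -- u at ν on the left and isolates v(ν) on the right.
  have hsum : ∀ z, (∑ μ, T.discChar ν μ * u μ) * T.thetaSum (fun κ => T.discChar ν (-κ)) τ z =
      (C * e (-(bil T.mat z z / τ))) * T.thetaSum
        (fun κ => if κ = ν then Nat.card T.discGroup * v ν else 0) w (fun i => z i / τ) := by
    intro z
    have hR : (fun κ => if κ = ν then (Nat.card T.discGroup : ℂ) * v ν else 0) =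
        fun κ => ∑ b, T.discChar ν (-b) * (v κ * T.discChar κ b) := by
      ext κ
      split_ifs with hκ
      · rw [hκ, sum_discChar_mul_discChar]
      · rw [T.sum_discChar_mul_discChar_of_ne v hκ]
    rw [hR, ← thetaSum_smul_left, thetaSum_sum, Finset.mul_sum]
    have hL : (fun κ => (∑ μ, T.discChar ν μ * u μ) * T.discChar ν (-κ)) =
        fun κ => ∑ b, T.discChar ν (-b) * u (κ - b) := by
      ext κ
      rw [sum_discChar_mul_sub, mul_comm]
    rw [hL, thetaSum_sum]
    refine Finset.sum_congr rfl fun b _ => ?_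
    rw [thetaSum_smul_left, thetaSum_smul_left, hshift b z]
    ring
  have hcard : (Nat.card T.discGroup : ℂ) ≠ 0 := by exact_mod_cast Nat.card_pos.ne'
  constructor
  · intro h0
    have h1 : (fun κ => if κ = ν then (Nat.card T.discGroup : ℂ) * v ν else 0) = fun _ => 0 := by
      refine T.thetaSum_injective (τ := w) fun z => ?_
      have h2 := hsum ((τ : ℂ) • z)
      have h3 : (fun i => ((τ : ℂ) • z) i / (τ : ℂ)) = z := by
        ext i; simp [hτ]
      rw [h0, zero_mul, h3] at h2
      rw [thetaSum_zero]
      exact (mul_eq_zero.mp h2.symm).resolve_left (mul_ne_zero hC (e_ne_zero _))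
    have h4 := congrFun h1 ν
    simp only [if_true] at h4
    exact (mul_eq_zero.mp h4).resolve_left hcard
  · intro h0
    have h1 : (fun κ => (∑ μ, T.discChar ν μ * u μ) * T.discChar ν (-κ)) = fun _ => 0 := by
      refine T.thetaSum_injective (τ := τ) fun z => ?_
      rw [thetaSum_smul_left, hsum z, h0, thetaSum_zero]
      simp [thetaSum_zero]
    -- At the index 0 the character equals 1, leaving the Fourier coefficient itself.
    have h4 := congrFun h1 0
    simpa using h4

/-- Modulo 1, T⁻¹[r/2] depends only on the class of r, so an integral shift of τ acts diagonally on
components. -/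
lemma thetaSum_of_coe_eq_add (u : T.discGroup → ℂ) {τ τ' : ℍ} {m : ℕ}
    (h : (τ' : ℂ) = τ + m) (z : Fin n → ℂ) :
    T.thetaSum u τ' z = T.thetaSum
      (fun μ => u μ * e (m * ((invValue T.mat (Quotient.out μ) : ℚ) : ℂ))) τ z := by
  refine (T.hasSum_thetaSum u τ' z).unique (hasSum_of_eq (T.hasSum_thetaSum _ τ z) fun r => ?_)
  have h1 : e (m * ((invValue T.mat (Quotient.out (Submodule.Quotient.mk r : T.discGroup)) : ℚ) : ℂ))
      = e (m * ((invValue T.mat r : ℚ) : ℂ)) := by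
    rw [e_natCast_mul, e_natCast_mul]
    congr 1
    rw [e_ratCast_eq_iff]
    apply invValue_sub_mem
    rw [← Submodule.Quotient.eq, mk_out]
  rw [h1, thetaTerm, thetaTerm, h, mul_add, e_add, e_add, e_add, mul_comm _ (m : ℂ)]
  ring

/-- A function with a Fourier expansion as in the definition of Jacobi forms has, at each `τ`, an
expansion in the second variable. -/
lemma hasSum_of_hasFourierExpansion {N : ℕ} {ψ : ℍ → (Fin n → ℂ) → ℂ}
    {c : ℤ → (Fin n → ℤ) → ℂ} (h : HasFourierExpansion N ψ c) (τ : ℍ) (z : Fin n → ℂ) :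
    HasSum (fun r : Fin n → ℤ => (∑' m : ℤ, c m r * e ((m : ℂ) / (N : ℂ) * (τ : ℂ))) *
      e (∑ i, (r i : ℂ) * z i)) (ψ τ z) := by
  have h1 := (Equiv.prodComm _ _).hasSum_iff.mpr (h τ z)
  have h2 := h1.prod_fiberwise fun r => (h1.summable.prod_factor r).hasSum
  refine hasSum_of_eq h2 fun r => ?_
  rw [← tsum_mul_right]
  rfl

lemma eq_of_coe_eq_add {N : ℕ} (hN : N ≠ 0) {ψ : ℍ → (Fin n → ℂ) → ℂ}
    {c : ℤ → (Fin n → ℤ) → ℂ} (h : HasFourierExpansion N ψ c) {τ τ' : ℍ} {j : ℕ}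
    (hτ : (τ' : ℂ) = τ + (j * N : ℕ)) (z : Fin n → ℂ) : ψ τ' z = ψ τ z := by
  refine (h τ' z).unique (hasSum_of_eq (h τ z) fun p => ?_)
  congr 2
  have hN' : (N : ℂ) ≠ 0 := by exact_mod_cast hN
  have h1 : (p.1 : ℂ) / (N : ℂ) * (τ' : ℂ) =
      (p.1 : ℂ) / (N : ℂ) * (τ : ℂ) + ((p.1 * j : ℤ) : ℂ) := by
    rw [hτ]; push_cast; field_simp
  rw [h1, e_add, e_intCast, mul_one]

lemma slash_one (k : ℤ) (φ : ℍ → (Fin n → ℂ) → ℂ) : slash k T.mat φ 1 = φ := by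
  ext τ z
  simp [slash, e_zero]

lemma slash_S (k : ℤ) (φ : ℍ → (Fin n → ℂ) → ℂ) (τ : ℍ) (z : Fin n → ℂ) :
    slash k T.mat φ ModularGroup.S τ z =
      φ (ModularGroup.S • τ) (fun i => z i / τ) * (τ : ℂ) ^ (-k) * e (-(bil T.mat z z / τ)) := by
  simp [slash, ModularGroup.S]

/-- Inversion turns the shift of z by xτ into the integral shift of z/τ by x, under which φ is
invariant; the factor comes from e(-T[z]/τ). -/
lemma elliptic_slash_S {k : ℤ} {N : ℕ} {χ : DirichletCharacter ℂ N} {φ : ℍ → (Fin n → ℂ) → ℂ}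
    (hφ : IsJacobiForm k T.mat N χ φ) (x : Fin n → ℤ) (τ : ℍ) (z : Fin n → ℂ) :
    slash k T.mat φ ModularGroup.S τ (fun i => z i + (x i : ℂ) * (τ : ℂ)) =
      e (-(bil T.mat (fun i => (x i : ℂ)) (fun i => (x i : ℂ)) * (τ : ℂ)
        + 2 * bil T.mat (fun i => (x i : ℂ)) z)) * slash k T.mat φ ModularGroup.S τ z := by
  have hτ : (τ : ℂ) ≠ 0 := τ.ne_zero
  rw [slash_S, slash_S]
  have h1 := hφ.elliptic 0 x (ModularGroup.S • τ) (fun i => z i / τ)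
  have hz : bil T.mat (fun i => ((0 : Fin n → ℤ) i : ℂ)) (fun i => z i / τ) = 0 := by
    simp [bil, dotProduct]
  have hz' : bil T.mat (fun i => ((0 : Fin n → ℤ) i : ℂ)) (fun i => ((0 : Fin n → ℤ) i : ℂ)) = 0 := by
    simp [bil, dotProduct]
  rw [hz, hz', zero_mul, mul_zero, add_zero, neg_zero, e_zero, one_mul] at h1
  have h2 : (fun i => (z i + (x i : ℂ) * (τ : ℂ)) / (τ : ℂ)) = fun i => z i / (τ : ℂ) +
      ((0 : Fin n → ℤ) i : ℂ) * ((ModularGroup.S • τ : ℍ) : ℂ) + (x i : ℂ) := by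
    ext i
    simp only [Pi.zero_apply, Int.cast_zero, zero_mul, add_zero]
    field_simp
  rw [h2, h1]
  set X : Fin n → ℂ := fun i => (x i : ℂ) with hX
  have h3 : (fun i => z i + (x i : ℂ) * (τ : ℂ)) = z + (τ : ℂ) • X := by
    ext i; simp [hX, mul_comm]
  rw [h3, T.bil_add_smul_self_div hτ, neg_add, e_add]
  ring

lemma exists_thetaSum_eq_of_isJacobiForm {k : ℤ} {N : ℕ} {χ : DirichletCharacter ℂ N}
    {φ : ℍ → (Fin n → ℂ) → ℂ} (hφ : IsJacobiForm k T.mat N χ φ) (τ : ℍ) :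
    ∃ u : T.discGroup → ℂ, ∀ z, φ τ z = T.thetaSum u τ z := by
  obtain ⟨c, hc, -⟩ := hφ.regular 1
  rw [slash_one] at hc
  refine T.exists_thetaSum_eq τ (φ τ) _ (hasSum_of_hasFourierExpansion hc τ) fun x z => ?_
  simpa using hφ.elliptic x 0 τ z

lemma exists_thetaSum_eq_slash_S {k : ℤ} {N : ℕ} {χ : DirichletCharacter ℂ N}
    {φ : ℍ → (Fin n → ℂ) → ℂ} (hφ : IsJacobiForm k T.mat N χ φ) (τ : ℍ) :
    ∃ u : T.discGroup → ℂ, ∀ z, slash k T.mat φ ModularGroup.S τ z = T.thetaSum u τ z := by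
  obtain ⟨c, hc, -⟩ := hφ.regular ModularGroup.S
  exact T.exists_thetaSum_eq τ _ _ (hasSum_of_hasFourierExpansion hc τ)
    fun x z => T.elliptic_slash_S hφ x τ z

lemma existsUnique_isThetaDecomposition {k : ℤ} {N : ℕ} {χ : DirichletCharacter ℂ N}
    {φ : ℍ → (Fin n → ℂ) → ℂ} (hφ : IsJacobiForm k T.mat N χ φ) :
    ∃! h : T.discGroup → ℍ → ℂ, T.IsThetaDecomposition φ h := by
  choose u hu using T.exists_thetaSum_eq_of_isJacobiForm hφ
  refine ⟨fun μ τ => u τ μ, hu, fun h hh => ?_⟩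
  ext μ τ
  have : (fun μ => h μ τ) = u τ := T.thetaSum_injective fun z => (hh τ z).symm.trans (hu τ z)
  exact congrFun this μ

variable {T} in
/-- A Jacobi form whose theta components at the generators of the discriminant group vanish is
zero. -/
lemma IsFundamental.eq_zero_of_components_eq_zero (hT : T.IsFundamental) {k : ℤ} {N : ℕ}
    (hN : Odd N) (hcop : IsCoprime T.disc.num (N : ℤ)) {χ : DirichletCharacter ℂ N}
    {φ : ℍ → (Fin n → ℂ) → ℂ} (hφ : IsJacobiForm k T.mat N χ φ) {h : T.discGroup → ℍ → ℂ}
    (hh : T.IsThetaDecomposition φ h)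
    (h0 : ∀ μ, addOrderOf μ = Nat.card T.discGroup → h μ = 0) : φ = 0 := by
  classical
  choose u hu using T.exists_thetaSum_eq_slash_S hφ
  obtain ⟨c, hc, -⟩ := hφ.regular ModularGroup.S
  have hN0 : N ≠ 0 := hN.pos.ne'
  have hiff : ∀ (τ : ℍ) (ν : T.discGroup),
      ∑ μ, T.discChar ν μ * u τ μ = 0 ↔ h ν (ModularGroup.S • τ) = 0 := fun τ =>
    T.fourier_component_eq_zero_iff (v := fun ν => h ν (ModularGroup.S • τ))
      (zpow_ne_zero (-k) τ.ne_zero) fun z => by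
        rw [← hu, slash_S, hh, thetaSum]
        ring
  have hzero : ∀ (τ : ℍ) (ν : T.discGroup), ∑ μ, T.discChar ν μ * u τ μ = 0 := by
    intro τ
    refine fourier_eq_zero_of_vanish_on_generators hT.squarefree_card T.discChar T.discChar_comm
      T.eq_zero_of_discChar_eq_one
      -- The inverse appears because the components at τ + jN are those at τ times e(-jNQ(μ)).
      (fun μ => (e (N * ((invValue T.mat (Quotient.out μ) : ℚ) : ℂ)))⁻¹) (u τ) ?_ ?_
    · intro μ ν hμν a b hab ha
      rw [_root_.inv_inj, ← Rat.cast_natCast, ← Rat.cast_mul, ← Rat.cast_mul, e_ratCast_eq_iff,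
        ← mul_sub] at hμν
      rw [← T.mk_out μ] at ha
      rw [← T.mk_out ν]
      exact hT.nsmul_eq_zero_of_invValue (hT.isCoprime_level hN hcop) hμν hab ha
    · intro ν hν j
      -- The j-th moment condition at τ is the vanishing of h_ν at S(τ + jN).
      set τ' : ℍ := ((j * N : ℕ) : ℝ) +ᵥ τ with hτ'
      have hcoe : (τ' : ℂ) = τ + (j * N : ℕ) := by
        rw [hτ', UpperHalfPlane.coe_vadd, add_comm]; push_cast; rfl
      have hu' : u τ = fun μ => u τ' μ *
          e ((j * N : ℕ) * ((invValue T.mat (Quotient.out μ) : ℚ) : ℂ)) := by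
        refine T.thetaSum_injective (τ := τ) fun z => ?_
        rw [← hu, ← thetaSum_of_coe_eq_add T (u τ') hcoe, ← hu]
        exact (eq_of_coe_eq_add hN0 hc hcoe z).symm
      rw [← (hiff τ' ν).mpr (by rw [h0 ν hν]; rfl)]
      refine Finset.sum_congr rfl fun μ _ => ?_
      rw [congrFun hu' μ, Nat.cast_mul, mul_assoc (j : ℂ), e_natCast_mul, inv_pow]
      have := pow_ne_zero j (e_ne_zero (N * ((invValue T.mat (Quotient.out μ) : ℚ) : ℂ)))
      field_simp
  ext w z
  obtain ⟨τ, rfl⟩ : ∃ τ : ℍ, ModularGroup.S • τ = w :=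
    ⟨ModularGroup.S⁻¹ • w, smul_inv_smul _ _⟩
  rw [hh]
  refine Finset.sum_eq_zero fun ν _ => ?_
  rw [(hiff τ ν).mp (hzero τ ν), zero_mul]

end PosHalfIntegral

end JacobiForms

theorem theorem3p3 (n N : ℕ) (k : ℤ) (χ : DirichletCharacter ℂ N)
    (T : JacobiForms.PosHalfIntegral n) (φ : ℍ → (Fin n → ℂ) → ℂ)
    (hN : Odd N) (hT : T.IsFundamental) (hcop : IsCoprime T.disc.num (N : ℤ))
    (hφ : JacobiForms.IsJacobiCuspForm k T.mat N χ φ) (hφ0 : φ ≠ 0) :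
    (∃! h : T.discGroup → ℍ → ℂ, T.IsThetaDecomposition φ h) ∧
    (∀ h : T.discGroup → ℍ → ℂ, T.IsThetaDecomposition φ h →
      ∃ μ : Fin n → ℤ, h (Submodule.Quotient.mk μ) ≠ 0 ∧
        JacobiForms.HasMaxDenominator T.mat μ) ∧
    (∀ μ : Fin n → ℤ, JacobiForms.HasMaxDenominator T.mat μ →
      ((JacobiForms.invValue T.mat μ).den : ℚ) = if Even n then T.disc else 4 * T.disc) := by
  refine ⟨T.existsUnique_isThetaDecomposition hφ.toIsJacobiForm, fun h hh => ?_, fun μ hμ => ?_⟩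
  · by_contra! hcon
    refine hφ0 (hT.eq_zero_of_components_eq_zero hN hcop hφ.toIsJacobiForm hh fun μ hμ => ?_)
    obtain ⟨m, rfl⟩ := Submodule.Quotient.mk_surjective _ μ
    by_contra hne
    -- Generators attain the maximal denominator, so if no such component were nonzero, all
    -- components at generators would vanish.
    exact hcon m hne (hT.hasMaxDenominator hμ)
  · rw [hT.den_eq_level hμ, T.level_eq]
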